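/- **Setting.** Let $n\ge 2$ agents communicate over an undirected connected graph $\mathcal W$ on $[n]$. Let $W=(w_{ij})\in\mathbb R^{n\times n}$ be nonnegative, symmetric and stochastic ($W\mathbf 1=\mathbf 1$), where for $i\ne j$ one has $w_{ij},w_{ji}>0$ if $\{i,j\}$ is an edge of $\mathcal W$ and $w_{ij}=w_{ji}=0$ otherwise. Let $\lambda_1\ge\lambda_2\ge\dots\ge\lambda_n$ be the eigenvalues of $W$. Let $f_1,\dots,f_n:\mathbb R^p\to\mathbb R$ have $L$-Lipschitz gradients, and suppose $f=\frac1n\sum_i f_i$ is $\mu$-strongly convex, i.e. $\langle\nabla f(x)-\nabla f(x'),x-x'\rangle\ge\mu\|x-x'\|^2$ for all $x,x'$. Here $L,\mu>0$, and $x^*$ denotes the minimizer of $f$. For $k\ge-1$, agent $i$ observes $g_{i,k}=\nabla f_i(x_{i,k};\xi_{i,k})$, where the samples $\xi_{i,k}$ ($i\in[n]$, $k\ge -1$) are independent, $\mathbb E[g_{i,k}\mid x_{i,k}]=\nabla f_i(x_{i,k})$ and $\mathbb E[\|g_{i,k}-\nabla f_i(x_{i,k})\|^2\mid x_{i,k}]\le\sigma^2$,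 with $\sigma>0$. **Algorithm.** CEDAS with parameters $\alpha,\gamma$, stepsizes $\eta_k$ ($k\ge -1$), compression operator $\mathcal C:\mathbb R^p\to\mathbb R^p$, and deterministic initial values $x_{i,-1},h_{i,0}\in\mathbb R^p$ starts from $x_{i,0}=x_{i,-1}-\eta_{-1}g_{i,-1}$, $d_{i,0}=0$, $(h_w)_{i,0}=\sum_j w_{ij}h_{j,0}$. For $k\ge0$ it computes $$y_{i,k}=x_{i,k}-\eta_kg_{i,k}-d_{i,k},\quad q_{i,k}=\mathcal C(y_{i,k}-h_{i,k}),\quad \hat y_{i,k}=h_{i,k}+q_{i,k},\quad (\hat y_w)_{i,k}=(h_w)_{i,k}+\sum_j w_{ij}q_{j,k},$$ $$h_{i,k+1}=(1-\alpha)h_{i,k}+\alpha\hat y_{i,k},\qquad (h_w)_{i,k+1}=(1-\alpha)(h_w)_{i,k}+\alpha(\hat y_w)_{i,k},$$ $$d_{i,k+1}=d_{i,k}+\tfrac{\gamma}{2}\big(\hat y_{i,k}-(\hat y_w)_{i,k}\big),\qquad x_{i,k+1}=x_{i,k}-\eta_kg_{i,k}-d_{i,k+1}.$$ Run it without compression,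 that is, with $\mathcal C=\mathrm{id}$, and with $\alpha=1$, $\gamma=\tfrac12$, $\theta>18$ and $$\eta_k=\frac{\theta}{\mu(k+m)},\qquad m=\max\Big\{\frac{64\theta}{1-\lambda_2},\ \frac{16\sqrt2\,L}{\mu(1-\lambda_2)},\ \frac{3\theta L\sqrt6}{2\mu}\Big\}.$$ **Growth condition.** For constants $c_1,c_2,c_3>0$ and $0<q\le\frac{4\theta}{3}-1$ (automatic if $q\le 23$), $$\sum_{i=1}^n\|\nabla f_i(x^*)\|^2\le c_1n^3,\qquad \sum_{i=1}^n\|x_{i,-1}-x^*\|^2\le c_2n^2,\qquad \frac1{1-\lambda_2}\le c_3n^q.$$ For $A>0$, the transient time $K_T(A)$ is the least $K\in\mathbb N$ such that $\frac1n\sum_{i=1}^n\mathbb E\|x_{i,k}-x^*\|^2\le\frac{A}{nk}$ for all $k\ge K$, $k\ge1$ (and $K_T(A)=\infty$ if there is none). **Statement.** The transient time of CEDAS is of order $n/(1-\lambda_2)$ in the following sense. Given $\mu,L,\sigma>0$ and $\theta>18$, there is a constant $A>0$, depending only on $\mu,L,\sigma,\theta$, and for all $c_1,c_2,c_3,q$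 as above there is a constant $B>0$, depending only on $\mu,L,\sigma,\theta,c_1,c_2,c_3,q$, such that for every instance as above all the expectations $\mathbb E\|x_{i,k}-x^*\|^2$ ($k\ge 0$) are finite and $$K_T(A)\le B\,\frac{n}{1-\lambda_2}.$$ In particular, $A$ and $B$ do not depend on $n$, $p$, the graph, $W$, the functions $f_i$ or the samples. -/

import Mathlib

open MeasureTheory ProbabilityTheory
open scoped ENNReal

/-- The decision space `ℝ^p` with its Euclidean norm. -/
abbrev Vec (p : ℕ) : Type := EuclideanSpace ℝ (Fin p)

/-! ### Network -/

/-- `W` is a mixing matrix compliant with the undirected connected graph `G`. -/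
structure IsMixingMatrix {n : ℕ} (G : SimpleGraph (Fin n)) (W : Matrix (Fin n) (Fin n) ℝ) :
    Prop where
  connected : G.Connected
  pos_of_adj : ∀ i j, G.Adj i j → 0 < W i j ∧ 0 < W j i
  eq_zero_of_not_adj : ∀ i j, i ≠ j → ¬ G.Adj i j → W i j = 0 ∧ W j i = 0
  nonneg : ∀ i j, 0 ≤ W i j
  symm : W.IsHermitian
  stochastic : ∀ i, ∑ j, W i j = 1

/-- The second largest eigenvalue `λ₂` (with multiplicity) of a real symmetric matrix;
`eigenvalues₀` lists the eigenvalues in decreasing order, starting from index `0`. -/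
noncomputable def secondEigenvalue {n : ℕ} (hn : 2 ≤ n) {W : Matrix (Fin n) (Fin n) ℝ}
    (hW : W.IsHermitian) : ℝ :=
  hW.eigenvalues₀ ⟨1, by rw [Fintype.card_fin]; omega⟩

/-! ### Objective functions -/

/-- The global objective `f = (1/n) ∑ᵢ fᵢ`. -/
noncomputable def avgObjective {n p : ℕ} (f : Fin n → Vec p → ℝ) : Vec p → ℝ :=
  fun x => (1 / (n : ℝ)) * ∑ i, f i x

/-- Each `fᵢ` has an `L`-Lipschitz gradient, and the average is `μ`-strongly convex. -/
structure SmoothStronglyConvex {n p : ℕ} (f : Fin n → Vec p → ℝ) (μ L : ℝ) : Prop where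
  differentiable : ∀ i, Differentiable ℝ (f i)
  lipschitz : ∀ i x y, ‖gradient (f i) x - gradient (f i) y‖ ≤ L * ‖x - y‖
  strongly_convex : ∀ x y, μ * ‖x - y‖ ^ 2 ≤
    inner ℝ (gradient (avgObjective f) x - gradient (avgObjective f) y) (x - y)

/-! ### The CEDAS algorithm -/

/-- All local variables of the `n` agents: `x`, `d`, `h`, and the mixed copy `h_w`. -/
structure CedasState (n p : ℕ) where
  x : Fin n → Vec p
  d : Fin n → Vec p
  h : Fin n → Vec p
  hw : Fin n → Vec p

/-- The parameters of CEDAS: mixing matrix, compression operator, the two scalars `α`, `γ`,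
and the stepsizes `η_k`, `k ≥ -1`. -/
structure CedasParams (n p : ℕ) where
  W : Matrix (Fin n) (Fin n) ℝ
  compress : Vec p → Vec p
  α : ℝ
  γ : ℝ
  η : ℤ → ℝ

/-- The state at iteration `0`, from the initial values `x_{i,-1}`, `h_{i,0}` and the stochastic
gradients `grad i` evaluated at `x_{i,-1}`. -/
noncomputable def cedasInit {n p : ℕ} (c : CedasParams n p)
    (xinit hinit grad : Fin n → Vec p) : CedasState n p where
  x i := xinit i - c.η (-1) • grad i
  d _ := 0
  h := hinit
  hw i := ∑ j, c.W i j • hinit j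

/-- One iteration of CEDAS with stepsize `ηk`; `grad i` is the stochastic gradient of agent `i` at
its current point. The variables `q`, `yhat`, `yhatw` are those of the communication procedure.
Sums over all `j` agree with sums over the neighbours of `i` and `i` itself, as the other weights
vanish. -/
noncomputable def cedasStep {n p : ℕ} (c : CedasParams n p) (ηk : ℝ)
    (grad : Fin n → Vec p) (s : CedasState n p) : CedasState n p :=
  let y : Fin n → Vec p := fun i => s.x i - ηk • grad i - s.d i
  let q : Fin n → Vec p := fun i => c.compress (y i - s.h i)
  let yhat : Fin n → Vec p := fun i => s.h i + q i
  let yhatw : Fin n → Vec p := fun i => s.hw i + ∑ j, c.W i j • q j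
  let dnew : Fin n → Vec p := fun i => s.d i + (c.γ / 2) • (yhat i - yhatw i)
  { x := fun i => s.x i - ηk • grad i - dnew i
    d := dnew
    h := fun i => (1 - c.α) • s.h i + c.α • yhat i
    hw := fun i => (1 - c.α) • s.hw i + c.α • yhatw i }

/-- The state of CEDAS at iteration `k`. Here `g i x z` is the noisy gradient `∇fᵢ(x; z)` and
`z t i` is the sample of agent `i` used at iteration `t - 1` (so `z 0 i` is used at iteration
`-1`). -/
noncomputable def cedasState {n p : ℕ} {Ξ : Type*} (c : CedasParams n p)
    (g : Fin n → Vec p → Ξ → Vec p) (xinit hinit : Fin n → Vec p) (z : ℕ → Fin n → Ξ) :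
    ℕ → CedasState n p
  | 0 => cedasInit c xinit hinit (fun i => g i (xinit i) (z 0 i))
  | k + 1 =>
    let s := cedasState c g xinit hinit z k
    cedasStep c (c.η k) (fun i => g i (s.x i) (z (k + 1) i)) s

/-- The random iterate `x_{i,k}`, for samples `ξ i t` (agent `i`, iteration `t - 1`). -/
noncomputable def cedasIterate {n p : ℕ} {Ξ Ω : Type*} (c : CedasParams n p)
    (g : Fin n → Vec p → Ξ → Vec p) (xinit hinit : Fin n → Vec p) (ξ : Fin n → ℕ → Ω → Ξ)
    (i : Fin n) (k : ℕ) (ω : Ω) : Vec p :=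
  (cedasState c g xinit hinit (fun t j => ξ j t ω) k).x i

/-- The point `x_{i,t-1}` at which agent `i` evaluates its `t`-th noisy gradient, `t ≥ 0`. -/
noncomputable def cedasQuery {n p : ℕ} {Ξ Ω : Type*} (c : CedasParams n p)
    (g : Fin n → Vec p → Ξ → Vec p) (xinit hinit : Fin n → Vec p) (ξ : Fin n → ℕ → Ω → Ξ)
    (i : Fin n) : ℕ → Ω → Vec p
  | 0 => fun _ => xinit i
  | k + 1 => cedasIterate c g xinit hinit ξ i k

/-! ### Stochastic gradients -/

/-- Independent samples, and conditionally unbiased noisy gradients with conditional variance at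
most `σ²`, at the query points `X i t`. -/
structure StochasticGradients {n p : ℕ} {Ξ Ω : Type*} [MeasurableSpace Ξ] [MeasurableSpace Ω]
    (P : Measure Ω) (f : Fin n → Vec p → ℝ) (g : Fin n → Vec p → Ξ → Vec p)
    (ξ : Fin n → ℕ → Ω → Ξ) (X : Fin n → ℕ → Ω → Vec p) (σ : ℝ) : Prop where
  measurable_sample : ∀ i t, Measurable (ξ i t)
  measurable_grad : ∀ i, Measurable (fun a : Vec p × Ξ => g i a.1 a.2)
  indep : iIndepFun (fun (a : Fin n × ℕ) => ξ a.1 a.2) P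
  unbiased : ∀ i t,
    P[fun ω => g i (X i t ω) (ξ i t ω) | MeasurableSpace.comap (X i t) inferInstance]
      =ᵐ[P] fun ω => gradient (f i) (X i t ω)
  integrable_sq : ∀ i t,
    Integrable (fun ω => ‖g i (X i t ω) (ξ i t ω) - gradient (f i) (X i t ω)‖ ^ 2) P
  variance_le : ∀ i t, ∀ᵐ ω ∂P,
    (P[fun ω' => ‖g i (X i t ω') (ξ i t ω') - gradient (f i) (X i t ω')‖ ^ 2 |
      MeasurableSpace.comap (X i t) inferInstance]) ω ≤ σ ^ 2

/-! ### Stepsizes and transient time -/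

/-- The stepsize `η_k = θ / (μ (k + m))`. -/
noncomputable def decreasingStepsize (θ μ m : ℝ) (k : ℤ) : ℝ := θ / (μ * ((k : ℝ) + m))

/-- The offset `m` in the stepsize, as a function of `λ₂`. -/
noncomputable def stepsizeOffset (θ μ L lam2 : ℝ) : ℝ :=
  max (64 * θ / (1 - lam2))
    (max (16 * √2 * L / (μ * (1 - lam2))) (3 * θ * L * √6 / (2 * μ)))

/-- CEDAS without compression: identity compressor, `α = 1`, `γ = 1/2`, and the decreasing
stepsize. -/
noncomputable def uncompressedParams {n : ℕ} (p : ℕ) (W : Matrix (Fin n) (Fin n) ℝ)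
    (θ μ L lam2 : ℝ) : CedasParams n p where
  W := W
  compress := id
  α := 1
  γ := 1 / 2
  η := decreasingStepsize θ μ (stepsizeOffset θ μ L lam2)

/-- The total expected error `(1/n) ∑ᵢ E ‖x_{i,k} - x⋆‖²`. -/
noncomputable def meanSquareError {n p : ℕ} {Ω : Type*} [MeasurableSpace Ω] (P : Measure Ω)
    (x : Fin n → ℕ → Ω → Vec p) (xstar : Vec p) (k : ℕ) : ℝ :=
  (1 / (n : ℝ)) * ∑ i, ∫ ω, ‖x i k ω - xstar‖ ^ 2 ∂P

/-- The transient time: the least `K` such that the error is at most `A / (n k)` for all `k ≥ K`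
(`k ≥ 1`), where `A` is the constant of the rate `O(1/(nk))`. It is `⊤` if there is no such `K`. -/
noncomputable def transientTime (n : ℕ) (err : ℕ → ℝ) (A : ℝ) : ℕ∞ :=
  ⨅ (K : ℕ) (_ : ∀ k : ℕ, K ≤ k → 1 ≤ k → err k ≤ A / ((n : ℝ) * (k : ℝ))), (K : ℕ∞)

/-! Without compression, `hw = W h` is an invariant and the algorithm becomes a primal-dual
iteration driven by `(I - W) / 4`: with `y = x - η g - d`, it sets `x' = y - (I - W) y / 4` and `d'
= d + (I - W) y / 4`. The errors are `x - x⋆` and `s = d + η_k ∇f_i(x⋆)`. Since the dual target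
moves with the stepsize, `s` carries a drift `(η_k - η_{k+1}) ∇f_i(x⋆)`, of size `O(1/k²)`. Random
vectors are replaced by their classes in `L²`, so that expected squares are Hilbert norms, noise is
orthogonal to the current errors, and one step (`ErrorStep`) is a deterministic statement.

In an eigenbasis of `W` the step splits into modes. In the consensus mode the dual error vanishes
and the iteration is stochastic gradient descent. Orthogonality of the agents' noises bounds the
noise energy there by `σ²` rather than `n σ²` (`mean_noise_sq`), and this is the source of the
factor `1/n` in the rate. A mode with eigenvalue `β ≥ δ = (1 - λ₂) / 4` contracts by exactly `1 - β`
in the norm `‖x‖² + (1 - β)/β ‖s‖²` (`rotation_norm_sq`), up to gradient, noise and drift.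

This gives coupled scalar recursions for the consensus energy `P` and the disagreement energy `Q`
(`EnergyRecursion`), with `t = k + m`. They are solved in two phases. Up to a time of order `1/δ`, a
Grönwall estimate loses only a constant factor (`crude_bound`). Afterwards an induction gives `Q ≤
H` and `P ≤ ν/t + (K + 1) H`, where `H = gapBound` is a sum of `N/(δ t²)`, `N³/(δ³ t⁴)` and a power
`t^(-3θ/2)` carrying the initial energy (`EnergyRecursion.bound`). Once `k ≥ B N/δ`, every term of
`H` is `O(1/k)` (`gapBound_le`); the growth condition on `1/δ` serves to absorb the initial energy.
Division by `n` gives the rate `A/(nk)`. -/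

/-! ### Spectral decomposition of the mixing matrix. -/

/-- An orthonormal eigenbasis `U` of a mixing matrix `W`, recorded through the eigenvalues `β` of
`(I - W) / 4`: the mode `a₀` is the consensus direction, all others have `β ≥ δ`. -/
structure GapBasis {n : ℕ} (W : Matrix (Fin n) (Fin n) ℝ) (δ : ℝ) where
  U : Fin n → Fin n → ℝ
  β : Fin n → ℝ
  a₀ : Fin n
  orthonormal : ∀ a b, ∑ i, U a i * U b i = if a = b then 1 else 0
  complete : ∀ i j, ∑ a, U a i * U a j = if i = j then 1 else 0
  eigen : ∀ a i, ∑ j, W i j * U a j = (1 - 4 * β a) * U a i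
  beta_zero : β a₀ = 0
  const : ∀ i j, U a₀ i = U a₀ j
  le_beta : ∀ a, a ≠ a₀ → δ ≤ β a
  beta_nonneg : ∀ a, 0 ≤ β a
  beta_le : ∀ a, β a ≤ 1 / 2

namespace IsMixingMatrix

variable {n : ℕ} {G : SimpleGraph (Fin n)} {W : Matrix (Fin n) (Fin n) ℝ}

lemma apply_comm (hW : IsMixingMatrix G W) (i j : Fin n) : W i j = W j i := by
  simpa using (hW.symm.apply i j).symm

lemma sum_col (hW : IsMixingMatrix G W) (j : Fin n) : ∑ i, W i j = 1 := by
  rw [← hW.stochastic j]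
  exact Finset.sum_congr rfl fun i _ => hW.apply_comm i j

/-- Dirichlet forms of `I - W` and `I + W` at once: `e = 1` and `e = -1` yield the upper and the
lower bound on the spectrum. -/
lemma sum_mul_sq (hW : IsMixingMatrix G W) (v : Fin n → ℝ) (l e : ℝ) (he : e ^ 2 = 1)
    (hv : ∀ i, ∑ j, W i j * v j = l * v i) :
    ∑ i, ∑ j, W i j * (v i - e * v j) ^ 2 = 2 * (1 - e * l) * ∑ i, v i ^ 2 := by
  have h1 : ∑ i, ∑ j, W i j * v i ^ 2 = ∑ i, v i ^ 2 :=
    Finset.sum_congr rfl fun i _ => by rw [← Finset.sum_mul, hW.stochastic, one_mul]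
  have h2 : ∑ i, ∑ j, W i j * v j ^ 2 = ∑ i, v i ^ 2 := by
    rw [Finset.sum_comm]
    exact Finset.sum_congr rfl fun i _ => by rw [← Finset.sum_mul, hW.sum_col, one_mul]
  have h3 : ∑ i, ∑ j, W i j * v j * v i = l * ∑ i, v i ^ 2 := by
    rw [Finset.mul_sum]
    exact Finset.sum_congr rfl fun i _ => by rw [← Finset.sum_mul, hv]; ring
  calc ∑ i, ∑ j, W i j * (v i - e * v j) ^ 2
      = ∑ i, ∑ j, W i j * v i ^ 2 - 2 * e * ∑ i, ∑ j, W i j * v j * v i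
        + e ^ 2 * ∑ i, ∑ j, W i j * v j ^ 2 := by
        simp only [Finset.mul_sum, ← Finset.sum_sub_distrib, ← Finset.sum_add_distrib]
        exact Finset.sum_congr rfl fun i _ => Finset.sum_congr rfl fun j _ => by ring
    _ = _ := by rw [h1, h2, h3, he]; ring

lemma abs_eigenvalue_le (hW : IsMixingMatrix G W) {v : Fin n → ℝ} {l : ℝ}
    (hv1 : ∑ i, v i ^ 2 = 1) (hv : ∀ i, ∑ j, W i j * v j = l * v i) : -1 ≤ l ∧ l ≤ 1 := by
  have h : ∀ e : ℝ, e ^ 2 = 1 → 0 ≤ 2 * (1 - e * l) := fun e he => by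
    have h1 := hW.sum_mul_sq v l e he hv
    rw [hv1, mul_one] at h1
    rw [← h1]
    exact Finset.sum_nonneg fun i _ => Finset.sum_nonneg fun j _ =>
      mul_nonneg (hW.nonneg i j) (sq_nonneg _)
  have h1 := h 1 (by norm_num)
  have h2 := h (-1) (by norm_num)
  constructor <;> linarith

/-- The Dirichlet form vanishes at `v`, so `v` agrees across every edge; connectedness does the
rest. -/
lemma const_of_eigenvalue_one (hW : IsMixingMatrix G W) {v : Fin n → ℝ}
    (hv : ∀ i, ∑ j, W i j * v j = v i) (i j : Fin n) : v i = v j := by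
  have h1 := hW.sum_mul_sq v 1 1 (by norm_num) (by simpa using hv)
  have hnn : ∀ i j, 0 ≤ W i j * (v i - 1 * v j) ^ 2 := fun i j =>
    mul_nonneg (hW.nonneg i j) (sq_nonneg _)
  have h2 : ∑ i, ∑ j, W i j * (v i - 1 * v j) ^ 2 = 0 := by rw [h1]; ring
  have hadj : ∀ i j, G.Adj i j → v i = v j := fun i j hij => by
    have h3 := (Finset.sum_eq_zero_iff_of_nonneg
      (fun i _ => Finset.sum_nonneg fun j _ => hnn i j)).1 h2 i (Finset.mem_univ _)
    have h4 := (Finset.sum_eq_zero_iff_of_nonneg (fun j _ => hnn i j)).1 h3 j (Finset.mem_univ _)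
    have h5 := (mul_eq_zero.1 h4).resolve_left (hW.pos_of_adj i j hij).1.ne'
    have h6 := pow_eq_zero_iff (two_ne_zero) |>.1 h5
    linarith
  obtain ⟨w⟩ := hW.connected.preconnected i j
  induction w with
  | nil => rfl
  | cons h _ ih => exact (hadj _ _ h).trans ih

lemma exists_gapBasis (hW : IsMixingMatrix G W) (hn : 2 ≤ n) :
    -1 ≤ secondEigenvalue hn hW.symm ∧ secondEigenvalue hn hW.symm < 1 ∧
      Nonempty (GapBasis W ((1 - secondEigenvalue hn hW.symm) / 4)) := by
  set e := (Fintype.equivOfCardEq (Fintype.card_fin (Fintype.card (Fin n))) :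
    Fin (Fintype.card (Fin n)) ≃ Fin n) with he
  set U : Fin n → Fin n → ℝ := fun a i => hW.symm.eigenvectorBasis a i with hU
  set l : Fin n → ℝ := hW.symm.eigenvalues with hl
  have hl0 : ∀ j, l (e j) = hW.symm.eigenvalues₀ j := fun j => by
    simp [hl, Matrix.IsHermitian.eigenvalues, he]
  have horth : ∀ a b, ∑ i, U a i * U b i = if a = b then 1 else 0 := fun a b => by
    have h := orthonormal_iff_ite.1 hW.symm.eigenvectorBasis.orthonormal a b
    rw [← h]
    simp [hU, PiLp.inner_apply, mul_comm]
  have hcomp : ∀ i j, ∑ a, U a i * U a j = if i = j then 1 else 0 := fun i j => by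
    have h : (Matrix.of U) * (Matrix.of U).transpose = 1 := by
      ext a b
      simp [Matrix.mul_apply, horth, Matrix.one_apply]
    have h2 := mul_eq_one_comm.1 h
    have h' := congrFun (congrFun h2 i) j
    simpa [Matrix.mul_apply, Matrix.one_apply] using h'
  have heig : ∀ a i, ∑ j, W i j * U a j = l a * U a i := fun a i => by
    have h := congrFun (hW.symm.mulVec_eigenvectorBasis a) i
    simpa [Matrix.mulVec, dotProduct] using h
  have hnorm : ∀ a, ∑ i, U a i ^ 2 = 1 := fun a => by
    have := horth a a
    simpa [sq] using this
  have habs : ∀ a, -1 ≤ l a ∧ l a ≤ 1 := fun a => hW.abs_eigenvalue_le (hnorm a) (heig a)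
  -- An eigenvector with eigenvalue other than `1` has entries summing to zero, because columns of
  -- `W` sum to `1`. If all were of this kind, no vector with nonzero sum could be expanded in the
  -- basis.
  have hone : ∃ a, l a = 1 := by
    by_contra! hne
    have hz : ∀ a, ∑ i, U a i = 0 := fun a => by
      have h : ∑ i, U a i = l a * ∑ i, U a i := by
        calc ∑ i, U a i = ∑ j, ∑ i, W i j * U a j :=
              Finset.sum_congr rfl fun j _ => by rw [← Finset.sum_mul, hW.sum_col, one_mul]
          _ = l a * ∑ i, U a i := by
              rw [Finset.sum_comm, Finset.mul_sum]
              exact Finset.sum_congr rfl fun i _ => heig a i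
      have h2 : (1 - l a) * ∑ i, U a i = 0 := by linarith
      exact (mul_eq_zero.1 h2).resolve_left (sub_ne_zero.2 (hne a).symm)
    let i0 : Fin n := ⟨0, by omega⟩
    have h1 : ∑ j, ∑ a, U a i0 * U a j = 1 := by simp [hcomp]
    rw [Finset.sum_comm] at h1
    simp [← Finset.mul_sum, hz] at h1
  obtain ⟨a₀, ha₀⟩ := hone
  have hconst : ∀ a, l a = 1 → ∀ i j, U a i = U a j := fun a ha =>
    hW.const_of_eigenvalue_one (by simpa [ha] using heig a)
  -- Two constant vectors cannot be orthonormal, so the eigenvalue `1` is simple and `λ₂ < 1`.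
  have huniq : ∀ a, l a = 1 → a = a₀ := fun a ha => by
    by_contra hne
    let i0 : Fin n := ⟨0, by omega⟩
    have h1 := horth a a₀
    rw [if_neg hne, Finset.sum_congr rfl (fun i _ => by
      rw [hconst a ha i i0, hconst a₀ ha₀ i i0])] at h1
    have h2 := hnorm a
    have h3 := hnorm a₀
    rw [Finset.sum_congr rfl (fun i _ => by rw [hconst a ha i i0])] at h2
    rw [Finset.sum_congr rfl (fun i _ => by rw [hconst a₀ ha₀ i i0])] at h3
    simp only [Finset.sum_const, Finset.card_univ, Fintype.card_fin, nsmul_eq_mul] at h1 h2 h3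
    have h4 : (n : ℝ) ≠ 0 := by positivity
    rcases mul_eq_zero.1 ((mul_eq_zero.1 h1).resolve_left h4) with h | h
    · rw [h] at h2; simp at h2
    · rw [h] at h3; simp at h3
  have hanti := hW.symm.eigenvalues₀_antitone
  have hcard : Fintype.card (Fin n) = n := Fintype.card_fin n
  set z : Fin (Fintype.card (Fin n)) := ⟨0, by omega⟩ with hz
  set o : Fin (Fintype.card (Fin n)) := ⟨1, by omega⟩ with ho
  have ha₀z : e z = a₀ := by
    apply huniq
    refine le_antisymm (habs _).2 ?_
    rw [hl0, ← ha₀, ← e.apply_symm_apply a₀, hl0]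
    exact hanti (by rw [Fin.le_def]; simp [hz])
  have hlam : secondEigenvalue hn hW.symm = l (e o) := by rw [hl0]; rfl
  have hoz : e o ≠ a₀ := by
    rw [← ha₀z]
    intro h
    have := e.injective h
    simp [ho, hz] at this
  have hlt : l (e o) < 1 := lt_of_le_of_ne (habs _).2 fun h => hoz (huniq _ h)
  refine ⟨hlam ▸ (habs _).1, hlam ▸ hlt, ⟨?_⟩⟩
  exact
    { U := U
      β := fun a => (1 - l a) / 4
      a₀ := a₀
      orthonormal := horth
      complete := hcomp
      eigen := fun a i => by rw [heig]; ring
      beta_zero := by simp [ha₀]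
      const := hconst a₀ ha₀
      le_beta := fun a ha => by
        have h1 : l a ≤ l (e o) := by
          rw [hl0, ← e.apply_symm_apply a, hl0]
          apply hanti
          have h2 : e.symm a ≠ z := fun h => ha (by rw [← ha₀z, ← h, e.apply_symm_apply])
          rw [Fin.le_def]
          have h3 : (e.symm a).val ≠ 0 := fun h => h2 (Fin.ext h)
          simp only [ho]
          omega
        rw [hlam]
        linarith
      beta_nonneg := fun a => by have := (habs a).2; linarith
      beta_le := fun a => by have := (habs a).1; linarith }

end IsMixingMatrix

/-! ### Contraction of a single mode. -/

lemma norm_sub_sq_le_young {H : Type*} [SeminormedAddCommGroup H] (u v : H) {τ : ℝ} (hτ : 0 < τ) :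
    ‖u - v‖ ^ 2 ≤ (1 + τ) * ‖u‖ ^ 2 + (1 + 1 / τ) * ‖v‖ ^ 2 := by
  have h2 : ‖u - v‖ ^ 2 ≤ (‖u‖ + ‖v‖) ^ 2 := pow_le_pow_left₀ (norm_nonneg _) (norm_sub_le u v) 2
  have h3 : 0 ≤ τ * (‖u‖ - 1 / τ * ‖v‖) ^ 2 := by positivity
  have e : τ * (‖u‖ - 1 / τ * ‖v‖) ^ 2 = τ * ‖u‖ ^ 2 + 1 / τ * ‖v‖ ^ 2 - 2 * ‖u‖ * ‖v‖ := by
    field_simp; ring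
  linarith

/-- The primal-dual iteration of a single mode is a rotation followed by a contraction. -/
lemma rotation_norm_sq {H : Type*} [NormedAddCommGroup H] [InnerProductSpace ℝ H] {b : ℝ}
    (hb : b ≠ 0) (z s : H) :
    ‖(1 - b) • (z - s)‖ ^ 2 + (1 - b) / b * ‖s + b • (z - s)‖ ^ 2 =
      (1 - b) * (‖z‖ ^ 2 + (1 - b) / b * ‖s‖ ^ 2) := by
  obtain ⟨y, rfl⟩ : ∃ y, z = y + s := ⟨z - s, by abel⟩
  rw [add_sub_cancel_right, norm_smul, norm_add_sq_real, norm_add_sq_real, real_inner_smul_right,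
    norm_smul, real_inner_comm, mul_pow, mul_pow, Real.norm_eq_abs, Real.norm_eq_abs, sq_abs,
    sq_abs]
  field_simp
  ring

/-- Young's inequality with parameter `δ/4` is spent twice, on the drift (`h1`) and on the gradient
(`h2`), and `(1 + δ/4)² (1 - δ) ≤ 1 - δ/2` leaves half of the contraction. The noise `E` is already
split off in `key`, so it gets no factor `1/δ`. -/
lemma gap_mode_arith {δ b ρ η Δ X Y Gc E Fc A B C D : ℝ} (hδ : 0 < δ) (hδ' : δ ≤ 1 / 2)
    (hb : δ ≤ b) (hρ : 0 ≤ ρ) (hρ' : ρ ≤ 1 / δ) (hX : 0 ≤ X) (hY : 0 ≤ Y) (hG : 0 ≤ Gc)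
    (hE : 0 ≤ E) (hF : 0 ≤ Fc) (hA : 0 ≤ A) (hD : 0 ≤ D)
    (key : A + ρ * B = (1 - b) * ((D + η ^ 2 * E) + ρ * Y))
    (h1 : C ≤ (1 + δ / 4) * B + 5 / δ * (Δ ^ 2 * Fc))
    (h2 : D ≤ (1 + δ / 4) * X + 5 / δ * (η ^ 2 * Gc)) :
    A + ρ * C ≤ (1 - δ / 2) * (X + ρ * Y) + 5 / δ * η ^ 2 * Gc + η ^ 2 * E
      + 5 / δ ^ 2 * Δ ^ 2 * Fc := by
  have z1 := mul_le_mul_of_nonneg_left h1 hρ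
  have z2 : ρ * (5 / δ * (Δ ^ 2 * Fc)) ≤ 5 / δ ^ 2 * Δ ^ 2 * Fc := by
    calc ρ * (5 / δ * (Δ ^ 2 * Fc)) ≤ 1 / δ * (5 / δ * (Δ ^ 2 * Fc)) := by gcongr
      _ = _ := by field_simp
  -- `A` is enlarged to `(1 + δ/4) A`, to match the factor on `B` and make `key` applicable to the
  -- sum.
  have hA' : 0 ≤ δ / 4 * A := by positivity
  have w1 : A + ρ * C ≤ (1 + δ / 4) * ((1 - b) * ((D + η ^ 2 * E) + ρ * Y))
      + 5 / δ ^ 2 * Δ ^ 2 * Fc := by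
    rw [← key]; linarith
  have hb : (1 + δ / 4) * (1 - b) ≤ (1 + δ / 4) * (1 - δ) :=
    mul_le_mul_of_nonneg_left (by linarith) (by linarith)
  have w2 := mul_le_mul_of_nonneg_right hb (by positivity : 0 ≤ (D + η ^ 2 * E) + ρ * Y)
  have c0 : 0 ≤ (1 + δ / 4) * (1 - δ) := mul_nonneg (by linarith) (by linarith)
  have c1 : (1 + δ / 4) * (1 - δ) ≤ 1 - δ / 2 := by nlinarith
  have c2 : (1 + δ / 4) * (1 - δ) * (1 + δ / 4) ≤ 1 - δ / 2 := by nlinarith [pow_pos hδ 3]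
  have g1 := mul_le_mul_of_nonneg_left h2 c0
  have g2 := mul_le_mul_of_nonneg_right c2 hX
  have g3 := mul_le_mul_of_nonneg_right (c1.trans (by linarith : 1 - δ / 2 ≤ 1))
    (by positivity : 0 ≤ 5 / δ * (η ^ 2 * Gc))
  have g4 := mul_le_mul_of_nonneg_right (c1.trans (by linarith : 1 - δ / 2 ≤ 1))
    (by positivity : 0 ≤ η ^ 2 * E)
  have g5 := mul_le_mul_of_nonneg_right c1 (by positivity : 0 ≤ ρ * Y)
  linarith

/-! ### Modal coordinates and energies. -/

namespace GapBasis

variable {n : ℕ} {W : Matrix (Fin n) (Fin n) ℝ} {δ : ℝ} (S : GapBasis W δ)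
  {H : Type*} [NormedAddCommGroup H] [InnerProductSpace ℝ H]

/-- Coordinates of a family of vectors in the eigenbasis. -/
def coord : (Fin n → H) →ₗ[ℝ] (Fin n → H) where
  toFun x a := ∑ i, S.U a i • x i
  map_add' x y := by ext a; simp [Finset.sum_add_distrib]
  map_smul' c x := by
    ext a
    simp only [Pi.smul_apply, RingHom.id_apply, Finset.smul_sum]
    exact Finset.sum_congr rfl fun i _ => smul_comm _ _ _

lemma coord_apply (x : Fin n → H) (a : Fin n) : S.coord x a = ∑ i, S.U a i • x i := rfl

lemma sum_norm_sq_coord (x : Fin n → H) : ∑ a, ‖S.coord x a‖ ^ 2 = ∑ i, ‖x i‖ ^ 2 := by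
  have h : ∀ a, ‖S.coord x a‖ ^ 2 = ∑ i, ∑ j, S.U a i * S.U a j * inner ℝ (x i) (x j) := fun a => by
    rw [← real_inner_self_eq_norm_sq, coord_apply, sum_inner]
    refine Finset.sum_congr rfl fun i _ => ?_
    rw [inner_sum]
    refine Finset.sum_congr rfl fun j _ => ?_
    rw [real_inner_smul_left, real_inner_smul_right]; ring
  calc ∑ a, ‖S.coord x a‖ ^ 2 = ∑ a, ∑ i, ∑ j, S.U a i * S.U a j * inner ℝ (x i) (x j) :=
        Finset.sum_congr rfl fun a _ => h a
    _ = ∑ i, ∑ j, (∑ a, S.U a i * S.U a j) * inner ℝ (x i) (x j) := by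
        rw [Finset.sum_comm]
        refine Finset.sum_congr rfl fun i _ => ?_
        rw [Finset.sum_comm]
        exact Finset.sum_congr rfl fun j _ => by rw [Finset.sum_mul]
    _ = ∑ i, ‖x i‖ ^ 2 := by simp [S.complete]

lemma coord_mul (hW : ∀ i j, W i j = W j i) (y : Fin n → H) (a : Fin n) :
    S.coord (fun i => ∑ j, W i j • y j) a = (1 - 4 * S.β a) • S.coord y a := by
  simp only [coord_apply, Finset.smul_sum, smul_smul]
  rw [Finset.sum_comm]
  refine Finset.sum_congr rfl fun j _ => ?_
  rw [← Finset.sum_smul, ← S.eigen]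
  congr 1
  exact Finset.sum_congr rfl fun i _ => by rw [hW i j, mul_comm]

/-- The common entry of the consensus eigenvector. -/
def c₀ : ℝ := S.U S.a₀ S.a₀

lemma U_a₀ (i : Fin n) : S.U S.a₀ i = S.c₀ := S.const _ _

/-- Normalization of a constant unit vector; `c₀² = 1/n` is the averaging factor for the noise. -/
lemma card_mul_c₀_sq : (n : ℝ) * S.c₀ ^ 2 = 1 := by
  have h := S.orthonormal S.a₀ S.a₀
  simpa [S.U_a₀, sq] using h

lemma coord_a₀ (x : Fin n → H) : S.coord x S.a₀ = S.c₀ • ∑ i, x i := by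
  simp [coord_apply, S.U_a₀, Finset.smul_sum]

lemma sum_U_eq_zero {a : Fin n} (ha : a ≠ S.a₀) : ∑ i, S.U a i = 0 := by
  have h := S.orthonormal a S.a₀
  simp only [S.U_a₀, if_neg ha, ← Finset.sum_mul] at h
  refine (mul_eq_zero.1 h).resolve_right fun h0 => ?_
  have := S.card_mul_c₀_sq
  simp [h0] at this

lemma coord_const {a : Fin n} (ha : a ≠ S.a₀) (v : H) : S.coord (fun _ => v) a = 0 := by
  simp [coord_apply, ← Finset.sum_smul, S.sum_U_eq_zero ha]

/-- Subtracting the mean removes the consensus coordinate and leaves the others unchanged, since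
those eigenvectors have zero sum. -/
lemma sum_norm_sq_sub_mean (x : Fin n → H) :
    ∑ i, ‖x i - (1 / (n : ℝ)) • ∑ j, x j‖ ^ 2 =
      ∑ a ∈ Finset.univ.erase S.a₀, ‖S.coord x a‖ ^ 2 := by
  have hn : (n : ℝ) ≠ 0 := fun h => by have := S.card_mul_c₀_sq; simp [h] at this
  set v := (1 / (n : ℝ)) • ∑ j, x j with hv
  have h := S.sum_norm_sq_coord (x - fun _ => v)
  rw [← Finset.add_sum_erase _ _ (Finset.mem_univ S.a₀)] at h
  have h0 : S.coord (x - fun _ => v) S.a₀ = 0 := by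
    rw [coord_a₀]
    simp [Finset.sum_sub_distrib, hv, ← Nat.cast_smul_eq_nsmul ℝ, smul_smul, hn]
  simp only [h0, norm_zero, Pi.sub_apply] at h
  rw [← h]
  simp only [ne_eq, OfNat.ofNat_ne_zero, not_false_eq_true, zero_pow, zero_add]
  refine Finset.sum_congr rfl fun a ha => ?_
  rw [map_sub, Pi.sub_apply, S.coord_const (Finset.ne_of_mem_erase ha), sub_zero]

/-- Energy of the consensus mode. -/
noncomputable def meanEnergy (x : Fin n → H) : ℝ := ‖S.coord x S.a₀‖ ^ 2

/-- Energy of the disagreement modes of the pair of primal and dual variables. -/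
noncomputable def gapEnergy (x s : Fin n → H) : ℝ :=
  ∑ a ∈ Finset.univ.erase S.a₀,
    (‖S.coord x a‖ ^ 2 + (1 - S.β a) / S.β a * ‖S.coord s a‖ ^ 2)

lemma ratio_nonneg (a : Fin n) : 0 ≤ (1 - S.β a) / S.β a :=
  div_nonneg (by linarith [S.beta_le a]) (S.beta_nonneg a)

lemma ratio_le (hδ : 0 < δ) {a : Fin n} (ha : a ≠ S.a₀) : (1 - S.β a) / S.β a ≤ 1 / δ := by
  have h := S.le_beta a ha
  exact div_le_div₀ zero_le_one (by linarith [S.beta_nonneg a]) hδ h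

lemma sum_coord_sq_le_gapEnergy (x s : Fin n → H) :
    ∑ a ∈ Finset.univ.erase S.a₀, ‖S.coord x a‖ ^ 2 ≤ S.gapEnergy x s :=
  Finset.sum_le_sum fun a _ =>
    le_add_of_nonneg_right (mul_nonneg (S.ratio_nonneg a) (sq_nonneg _))

lemma meanEnergy_nonneg (x : Fin n → H) : 0 ≤ S.meanEnergy x := sq_nonneg _

lemma gapEnergy_nonneg (x s : Fin n → H) : 0 ≤ S.gapEnergy x s :=
  (Finset.sum_nonneg fun _ _ => sq_nonneg _).trans (S.sum_coord_sq_le_gapEnergy x s)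

lemma sum_norm_sq_le (x s : Fin n → H) :
    ∑ i, ‖x i‖ ^ 2 ≤ S.meanEnergy x + S.gapEnergy x s := by
  rw [← S.sum_norm_sq_coord, ← Finset.add_sum_erase _ _ (Finset.mem_univ S.a₀)]
  exact add_le_add le_rfl (S.sum_coord_sq_le_gapEnergy x s)

/-- Used at time `0` only, where `s` is of order `η_0 = O(δ)` and this pays for the weight `1/δ`. -/
lemma energy_le (hδ : 0 < δ) (x s : Fin n → H) :
    S.meanEnergy x + S.gapEnergy x s ≤ ∑ i, ‖x i‖ ^ 2 + 1 / δ * ∑ i, ‖s i‖ ^ 2 := by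
  rw [← S.sum_norm_sq_coord x, ← S.sum_norm_sq_coord s,
    ← Finset.add_sum_erase _ _ (Finset.mem_univ S.a₀),
    ← Finset.add_sum_erase (a := S.a₀) _ (fun a => ‖S.coord s a‖ ^ 2) (Finset.mem_univ _),
    meanEnergy, gapEnergy, Finset.sum_add_distrib, mul_add, Finset.mul_sum]
  have h : ∑ a ∈ Finset.univ.erase S.a₀, (1 - S.β a) / S.β a * ‖S.coord s a‖ ^ 2 ≤
      ∑ a ∈ Finset.univ.erase S.a₀, 1 / δ * ‖S.coord s a‖ ^ 2 :=
    Finset.sum_le_sum fun a ha =>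
      mul_le_mul_of_nonneg_right (S.ratio_le hδ (Finset.ne_of_mem_erase ha)) (sq_nonneg _)
  have h2 : 0 ≤ 1 / δ * ‖S.coord s S.a₀‖ ^ 2 := by positivity
  linarith

end GapBasis

/-! ### One-step energy estimates. -/

section Step

variable {n : ℕ} {H : Type*} [NormedAddCommGroup H] [InnerProductSpace ℝ H]

/-- One step of the uncompressed recursion for the errors `x`, `s` with gradient differences `G`,
noise `ε`, and drift `Δ • F` of the dual variable. -/
structure ErrorStep (W : Matrix (Fin n) (Fin n) ℝ) (η Δ L μ σ : ℝ)
    (x s G ε F x' s' : Fin n → H) : Prop where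
  x_eq : ∀ i, x' i = (x i - η • (G i + ε i) - s i) -
    (1 / 4 : ℝ) • ((x i - η • (G i + ε i) - s i) - ∑ j, W i j • (x j - η • (G j + ε j) - s j))
  s_eq : ∀ i, s' i = s i +
    (1 / 4 : ℝ) • ((x i - η • (G i + ε i) - s i) - ∑ j, W i j • (x j - η • (G j + ε j) - s j))
      - Δ • F i
  sum_s : ∑ i, s i = 0
  noise_x : ∀ i j, inner ℝ (ε i) (x j) = 0
  noise_G : ∀ i j, inner ℝ (ε i) (G j) = 0
  noise_noise : ∀ i j, i ≠ j → inner ℝ (ε i) (ε j) = 0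
  noise_sq : ∀ i, ‖ε i‖ ^ 2 ≤ σ ^ 2
  lipschitz : ∀ i, ‖G i‖ ≤ L * ‖x i‖
  mean : ∃ Γ : Fin n → H, (∀ i, ‖G i - Γ i‖ ≤ L * ‖x i - (1 / (n : ℝ)) • ∑ j, x j‖) ∧
    n * μ * ‖(1 / (n : ℝ)) • ∑ j, x j‖ ^ 2 ≤ inner ℝ (∑ i, Γ i) ((1 / (n : ℝ)) • ∑ j, x j)

namespace ErrorStep

variable {W : Matrix (Fin n) (Fin n) ℝ} {δ η Δ L μ σ : ℝ} {x s G ε F x' s' : Fin n → H}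
  (S : GapBasis W δ)

section
variable (h : ErrorStep W η Δ L μ σ x s G ε F x' s')
include h

lemma coord_x (hW : ∀ i j, W i j = W j i) (a : Fin n) :
    S.coord x' a = (1 - S.β a) • (S.coord x a - η • (S.coord G a + S.coord ε a) - S.coord s a) := by
  obtain ⟨y, hy⟩ : ∃ y, y = x - η • (G + ε) - s := ⟨_, rfl⟩
  have h1 : x' = y - (1 / 4 : ℝ) • (y - fun i => ∑ j, W i j • y j) := by
    subst hy; exact funext fun i => h.x_eq i
  have h2 : S.coord y a = S.coord x a - η • (S.coord G a + S.coord ε a) - S.coord s a := by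
    simp [hy]
  rw [h1, ← h2]
  simp only [map_sub, map_smul, Pi.sub_apply, Pi.smul_apply, S.coord_mul hW]
  module

lemma coord_s (hW : ∀ i j, W i j = W j i) (a : Fin n) :
    S.coord s' a = S.coord s a +
      S.β a • (S.coord x a - η • (S.coord G a + S.coord ε a) - S.coord s a) -
      Δ • S.coord F a := by
  obtain ⟨y, hy⟩ : ∃ y, y = x - η • (G + ε) - s := ⟨_, rfl⟩
  have h1 : s' = s + (1 / 4 : ℝ) • (y - fun i => ∑ j, W i j • y j) - Δ • F := by
    subst hy; exact funext fun i => h.s_eq i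
  have h2 : S.coord y a = S.coord x a - η • (S.coord G a + S.coord ε a) - S.coord s a := by
    simp [hy]
  rw [h1, ← h2]
  simp only [map_sub, map_add, map_smul, Pi.sub_apply, Pi.add_apply, Pi.smul_apply,
    S.coord_mul hW]
  module

lemma inner_noise_x (a b : Fin n) : inner ℝ (S.coord ε a) (S.coord x b) = 0 := by
  simp [GapBasis.coord_apply, sum_inner, inner_sum, real_inner_smul_left, real_inner_smul_right,
    h.noise_x]

lemma inner_noise_G (a b : Fin n) : inner ℝ (S.coord ε a) (S.coord G b) = 0 := by
  simp [GapBasis.coord_apply, sum_inner, inner_sum, real_inner_smul_left, real_inner_smul_right,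
    h.noise_G]

lemma sum_noise_sq : ∑ a, ‖S.coord ε a‖ ^ 2 ≤ n * σ ^ 2 := by
  rw [S.sum_norm_sq_coord]
  simpa using Finset.sum_le_sum fun i (_ : i ∈ Finset.univ) => h.noise_sq i

/-- Noises of different agents are orthogonal, so `‖∑ ε_i‖² = ∑ ‖ε_i‖² ≤ n σ²`, and the factor `c₀²
= 1/n` cancels `n`. -/
lemma mean_noise_sq : ‖S.coord ε S.a₀‖ ^ 2 ≤ σ ^ 2 := by
  rw [S.coord_a₀, norm_smul, mul_pow, ← real_inner_self_eq_norm_sq (∑ i, ε i), sum_inner]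
  have h1 : ∀ i, inner ℝ (ε i) (∑ j, ε j) = ‖ε i‖ ^ 2 := fun i => by
    rw [inner_sum, Finset.sum_eq_single i (fun j _ hj => h.noise_noise i j hj.symm) (by simp),
      real_inner_self_eq_norm_sq]
  simp only [h1, Real.norm_eq_abs, sq_abs]
  have h2 : ∑ i, ‖ε i‖ ^ 2 ≤ n * σ ^ 2 := by
    simpa using Finset.sum_le_sum fun i (_ : i ∈ Finset.univ) => h.noise_sq i
  calc S.c₀ ^ 2 * ∑ i, ‖ε i‖ ^ 2 ≤ S.c₀ ^ 2 * (n * σ ^ 2) := by gcongr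
    _ = (n * S.c₀ ^ 2) * σ ^ 2 := by ring
    _ = σ ^ 2 := by rw [S.card_mul_c₀_sq, one_mul]

/-- Pythagoras, applied before any use of Young's inequality, so that the noise keeps the
coefficient `η²`. -/
lemma norm_sq_sub_noise (a : Fin n) :
    ‖S.coord x a - η • (S.coord G a + S.coord ε a)‖ ^ 2 =
      ‖S.coord x a - η • S.coord G a‖ ^ 2 + η ^ 2 * ‖S.coord ε a‖ ^ 2 := by
  have h1 : S.coord x a - η • (S.coord G a + S.coord ε a) =
    (S.coord x a - η • S.coord G a) - η • S.coord ε a := by module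
  have h2 : inner ℝ (S.coord x a - η • S.coord G a) (η • S.coord ε a) = 0 := by
    rw [real_inner_comm, real_inner_smul_left, inner_sub_right, real_inner_smul_right,
      h.inner_noise_x, h.inner_noise_G]
    simp
  rw [h1, norm_sub_sq_real, h2, norm_smul, mul_pow, Real.norm_eq_abs, sq_abs]
  ring

lemma sum_G_sq :
    ∑ a, ‖S.coord G a‖ ^ 2 ≤ L ^ 2 * (S.meanEnergy x + S.gapEnergy x s) := by
  rw [S.sum_norm_sq_coord]
  calc ∑ i, ‖G i‖ ^ 2 ≤ ∑ i, L ^ 2 * ‖x i‖ ^ 2 := Finset.sum_le_sum fun i _ => by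
        rw [← mul_pow]; exact pow_le_pow_left₀ (norm_nonneg _) (h.lipschitz i) 2
    _ = L ^ 2 * ∑ i, ‖x i‖ ^ 2 := by rw [Finset.mul_sum]
    _ ≤ _ := by gcongr; exact S.sum_norm_sq_le x s

/-- Strong convexity holds only for the average objective, hence at a common point. The gradients
are compared with those at the mean iterate (`Γ`); the difference is controlled by the disagreement
energy, and the cross term costs an eighth of `μ`. -/
lemma le_inner_mean (hμ : 0 < μ) :
    7 / 8 * μ * S.meanEnergy x - 2 / μ * (L ^ 2 * S.gapEnergy x s) ≤
      inner ℝ (S.coord x S.a₀) (S.coord G S.a₀) := by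
  obtain ⟨Γ, hΓ1, hΓ2⟩ := h.mean
  have hn : (n : ℝ) ≠ 0 := fun h => by have := S.card_mul_c₀_sq; simp [h] at this
  set v := (1 / (n : ℝ)) • ∑ j, x j with hv
  have hx0 : S.coord x S.a₀ = (S.c₀ * n) • v := by
    rw [S.coord_a₀, hv, smul_smul]; congr 1; field_simp
  have hD : ‖S.coord (G - Γ) S.a₀‖ ^ 2 ≤ L ^ 2 * S.gapEnergy x s := by
    calc ‖S.coord (G - Γ) S.a₀‖ ^ 2 ≤ ∑ a, ‖S.coord (G - Γ) a‖ ^ 2 :=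
          Finset.single_le_sum (f := fun a => ‖S.coord (G - Γ) a‖ ^ 2)
            (fun a _ => sq_nonneg _) (Finset.mem_univ _)
      _ = ∑ i, ‖G i - Γ i‖ ^ 2 := S.sum_norm_sq_coord _
      _ ≤ ∑ i, L ^ 2 * ‖x i - v‖ ^ 2 := Finset.sum_le_sum fun i _ => by
          rw [← mul_pow]; exact pow_le_pow_left₀ (norm_nonneg _) (hΓ1 i) 2
      _ = L ^ 2 * ∑ a ∈ Finset.univ.erase S.a₀, ‖S.coord x a‖ ^ 2 := by
          rw [← Finset.mul_sum, S.sum_norm_sq_sub_mean]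
      _ ≤ _ := by gcongr; exact S.sum_coord_sq_le_gapEnergy x s
  have hΓ : μ * S.meanEnergy x ≤ inner ℝ (S.coord x S.a₀) (S.coord Γ S.a₀) := by
    have hc := S.card_mul_c₀_sq
    have hn0 : 0 ≤ (n : ℝ) * S.c₀ ^ 2 := by rw [hc]; exact zero_le_one
    rw [GapBasis.meanEnergy, hx0, S.coord_a₀ Γ, real_inner_smul_left, real_inner_smul_right,
      real_inner_comm, norm_smul, mul_pow, Real.norm_eq_abs, sq_abs]
    calc μ * ((S.c₀ * n) ^ 2 * ‖v‖ ^ 2) = (n * S.c₀ ^ 2) * (n * μ * ‖v‖ ^ 2) := by ring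
      _ ≤ (n * S.c₀ ^ 2) * inner ℝ (∑ i, Γ i) v := by gcongr
      _ = _ := by ring
  have hsplit : S.coord G S.a₀ = S.coord Γ S.a₀ + S.coord (G - Γ) S.a₀ := by
    rw [map_sub, Pi.sub_apply]; abel
  have hcs := neg_le_of_abs_le (abs_real_inner_le_norm (S.coord x S.a₀) (S.coord (G - Γ) S.a₀))
  rw [hsplit, inner_add_right]
  set X := ‖S.coord x S.a₀‖
  set D := ‖S.coord (G - Γ) S.a₀‖
  have hy : X * D ≤ μ / 8 * X ^ 2 + 2 / μ * D ^ 2 := by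
    have : 0 ≤ μ / 8 * (X - 4 / μ * D) ^ 2 := by positivity
    have e : μ / 8 * (X - 4 / μ * D) ^ 2 = μ / 8 * X ^ 2 + 2 / μ * D ^ 2 - X * D := by
      field_simp; ring
    linarith
  have hX : S.meanEnergy x = X ^ 2 := rfl
  have h2 : 2 / μ * D ^ 2 ≤ 2 / μ * (L ^ 2 * S.gapEnergy x s) := by gcongr
  nlinarith

/-- With `β = 0` and zero dual coordinate the mode performs a plain gradient step; expanding the
square and doubling `le_inner_mean` gives `7/4`. -/
theorem meanEnergy_le (hW : ∀ i j, W i j = W j i) (hμ : 0 < μ) (hη : 0 ≤ η) :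
    S.meanEnergy x' ≤ (1 - 7 / 4 * (η * μ)) * S.meanEnergy x
      + 4 / μ * η * L ^ 2 * S.gapEnergy x s
      + η ^ 2 * L ^ 2 * (S.meanEnergy x + S.gapEnergy x s) + η ^ 2 * σ ^ 2 := by
  have hs : S.coord s S.a₀ = 0 := by rw [S.coord_a₀, h.sum_s, smul_zero]
  have hx : S.meanEnergy x' =
      ‖S.coord x S.a₀ - η • S.coord G S.a₀‖ ^ 2 + η ^ 2 * ‖S.coord ε S.a₀‖ ^ 2 := by
    rw [← h.norm_sq_sub_noise, GapBasis.meanEnergy, h.coord_x S hW, S.beta_zero, hs, sub_zero,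
      sub_zero, one_smul]
  have h1 := h.le_inner_mean S hμ
  have h2 : ‖S.coord G S.a₀‖ ^ 2 ≤ L ^ 2 * (S.meanEnergy x + S.gapEnergy x s) :=
    (Finset.single_le_sum (f := fun a => ‖S.coord G a‖ ^ 2)
      (fun a _ => sq_nonneg _) (Finset.mem_univ _)).trans (h.sum_G_sq S)
  have h3 : η ^ 2 * ‖S.coord ε S.a₀‖ ^ 2 ≤ η ^ 2 * σ ^ 2 :=
    mul_le_mul_of_nonneg_left (h.mean_noise_sq S) (sq_nonneg _)
  have h4 : η ^ 2 * ‖S.coord G S.a₀‖ ^ 2 ≤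
    η ^ 2 * (L ^ 2 * (S.meanEnergy x + S.gapEnergy x s)) := by gcongr
  have h5 := mul_le_mul_of_nonneg_left h1 hη
  rw [hx, norm_sub_sq_real, real_inner_smul_right, norm_smul, mul_pow, Real.norm_eq_abs, sq_abs]
  have h6 : ‖S.coord x S.a₀‖ ^ 2 = S.meanEnergy x := rfl
  rw [h6]
  have e : 4 / μ = 2 * (2 / μ) := by ring
  rw [e]
  linarith

lemma gap_mode_le (hW : ∀ i j, W i j = W j i) (hδ : 0 < δ) (hδ' : δ ≤ 1 / 2) {a : Fin n}
    (ha : a ≠ S.a₀) :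
    ‖S.coord x' a‖ ^ 2 + (1 - S.β a) / S.β a * ‖S.coord s' a‖ ^ 2 ≤
      (1 - δ / 2) * (‖S.coord x a‖ ^ 2 + (1 - S.β a) / S.β a * ‖S.coord s a‖ ^ 2)
      + 5 / δ * η ^ 2 * ‖S.coord G a‖ ^ 2 + η ^ 2 * ‖S.coord ε a‖ ^ 2
      + 5 / δ ^ 2 * Δ ^ 2 * ‖S.coord F a‖ ^ 2 := by
  have hβ : δ ≤ S.β a := S.le_beta a ha
  have hρ := S.ratio_nonneg a
  have hρ' := S.ratio_le hδ ha
  have hτ : 0 < δ / 4 := by positivity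
  have hδ1 : 1 + 1 / (δ / 4) ≤ 5 / δ := by
    have : 1 ≤ 1 / δ := by rw [le_div_iff₀ hδ]; linarith
    have e : 5 / δ = 1 / δ + 1 / (δ / 4) := by field_simp; ring
    linarith
  have key := rotation_norm_sq (hδ.trans_le hβ).ne' (S.coord x a - η • (S.coord G a + S.coord ε a))
    (S.coord s a)
  rw [h.norm_sq_sub_noise S a] at key
  rw [h.coord_x S hW, h.coord_s S hW]
  have y1 := norm_sub_sq_le_young (S.coord s a + S.β a •
    (S.coord x a - η • (S.coord G a + S.coord ε a) - S.coord s a)) (Δ • S.coord F a) hτ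
  have y2 := norm_sub_sq_le_young (S.coord x a) (η • S.coord G a) hτ
  rw [norm_smul, mul_pow, Real.norm_eq_abs, sq_abs] at y1 y2
  have y1' := y1.trans (add_le_add_right (mul_le_mul_of_nonneg_right hδ1
    (by positivity : 0 ≤ Δ ^ 2 * ‖S.coord F a‖ ^ 2)) _)
  have y2' := y2.trans (add_le_add_right (mul_le_mul_of_nonneg_right hδ1
    (by positivity : 0 ≤ η ^ 2 * ‖S.coord G a‖ ^ 2)) _)
  exact gap_mode_arith hδ hδ' hβ hρ hρ' (sq_nonneg _) (sq_nonneg _) (sq_nonneg _) (sq_nonneg _)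
    (sq_nonneg _) (sq_nonneg _) (sq_nonneg _) key y1' y2'

theorem gapEnergy_le (hW : ∀ i j, W i j = W j i) (hδ : 0 < δ) (hδ' : δ ≤ 1 / 2) :
    S.gapEnergy x' s' ≤ (1 - δ / 2) * S.gapEnergy x s
      + 5 / δ * η ^ 2 * (L ^ 2 * (S.meanEnergy x + S.gapEnergy x s)) + η ^ 2 * (n * σ ^ 2)
      + 5 / δ ^ 2 * Δ ^ 2 * ∑ i, ‖F i‖ ^ 2 := by
  have h1 := Finset.sum_le_sum fun a (ha : a ∈ Finset.univ.erase S.a₀) =>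
    h.gap_mode_le S hW hδ hδ' (Finset.ne_of_mem_erase ha)
  have sub : ∀ v : Fin n → ℝ, (∀ a, 0 ≤ v a) → ∑ a ∈ Finset.univ.erase S.a₀, v a ≤ ∑ a, v a :=
    fun v hv => Finset.sum_le_sum_of_subset_of_nonneg (Finset.erase_subset _ _) fun a _ _ => hv a
  simp only [Finset.sum_add_distrib, ← Finset.mul_sum] at h1
  rw [← Finset.sum_add_distrib, ← Finset.sum_add_distrib] at h1
  have hG := (sub (fun a => ‖S.coord G a‖ ^ 2) fun a => sq_nonneg _).trans (h.sum_G_sq S)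
  have hE := (sub (fun a => ‖S.coord ε a‖ ^ 2) fun a => sq_nonneg _).trans (h.sum_noise_sq S)
  have hF := (sub (fun a => ‖S.coord F a‖ ^ 2) fun a => sq_nonneg _).trans_eq
    (S.sum_norm_sq_coord F)
  have hG' := mul_le_mul_of_nonneg_left hG (by positivity : 0 ≤ 5 / δ * η ^ 2)
  have hE' := mul_le_mul_of_nonneg_left hE (by positivity : 0 ≤ η ^ 2)
  have hF' := mul_le_mul_of_nonneg_left hF (by positivity : 0 ≤ 5 / δ ^ 2 * Δ ^ 2)
  unfold GapBasis.gapEnergy at hG' ⊢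
  linarith

end

end ErrorStep

end Step

/-! ### Scalar recursions and the transient time. -/

/-- Bernoulli's inequality for `(1 - 1/(t + 1))^r`. -/
lemma one_sub_div_le_rpow {t r : ℝ} (ht : 0 < t) (hr : 1 ≤ r) : 1 - r / t ≤ (t / (t + 1)) ^ r := by
  have h1 : -1 ≤ -(1 / (t + 1)) := by
    rw [neg_le_neg_iff, div_le_one (by positivity)]; linarith
  have h2 := one_add_mul_self_le_rpow_one_add h1 hr
  have e : 1 + -(1 / (t + 1)) = t / (t + 1) := by field_simp; ring
  rw [e] at h2
  refine le_trans ?_ h2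
  have h3 : r * (1 / (t + 1)) ≤ r / t := by
    rw [mul_one_div]; exact div_le_div_of_nonneg_left (by linarith) ht (by linarith)
  linarith

lemma one_sub_div_le_pow {t r : ℝ} {s : ℕ} (ht : 0 < t) (hs : 1 ≤ s) (hr : s ≤ r) :
    1 - r / t ≤ (t / (t + 1)) ^ s := by
  have h := one_sub_div_le_rpow (r := s) ht (by exact_mod_cast hs)
  rw [Real.rpow_natCast] at h
  refine le_trans ?_ h
  gcongr

/-- Comparison function for the disagreement energy. -/
noncomputable def gapBound (N δ b c e t₀ r t : ℝ) : ℝ :=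
  b * N / (δ * t ^ 2) + c * N ^ 3 / (δ ^ 3 * t ^ 4) + e * (t₀ / t) ^ r

/-- The terms decay like `t^(-2)`, `t^(-4)` and `t^(-r)`; as `r ≥ 4`, none decays faster than the
factor `1 - r/t` allows. -/
lemma gapBound_step {N δ b c e t₀ r t : ℝ} (hN : 0 ≤ N) (hδ : 0 < δ) (hb : 0 ≤ b) (hc : 0 ≤ c)
    (he : 0 ≤ e) (ht₀ : 0 ≤ t₀) (hr : 4 ≤ r) (ht : 0 < t) :
    (1 - r / t) * gapBound N δ b c e t₀ r t ≤ gapBound N δ b c e t₀ r (t + 1) := by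
  have h2 := one_sub_div_le_pow (s := 2) ht (by norm_num) (by push_cast; linarith : ((2 : ℕ) : ℝ) ≤ r)
  have h4 := one_sub_div_le_pow (s := 4) ht (by norm_num) (by push_cast; linarith : ((4 : ℕ) : ℝ) ≤ r)
  have hr' := one_sub_div_le_rpow ht (by linarith : 1 ≤ r)
  unfold gapBound
  have e2 : b * N / (δ * (t + 1) ^ 2) = (t / (t + 1)) ^ 2 * (b * N / (δ * t ^ 2)) := by
    field_simp
  have e4 : c * N ^ 3 / (δ ^ 3 * (t + 1) ^ 4) =
      (t / (t + 1)) ^ 4 * (c * N ^ 3 / (δ ^ 3 * t ^ 4)) := by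
    field_simp
  have er : e * (t₀ / (t + 1)) ^ r = (t / (t + 1)) ^ r * (e * (t₀ / t) ^ r) := by
    have : t₀ / (t + 1) = t / (t + 1) * (t₀ / t) := by field_simp
    rw [this, Real.mul_rpow (by positivity) (by positivity)]; ring
  rw [e2, e4, er, mul_add, mul_add]
  gcongr

/-- The coupled recursions satisfied by the mean energy `P` and the disagreement energy `Q`. -/
structure EnergyRecursion (θ K ν N δ m D : ℝ) (P Q : ℕ → ℝ) : Prop where
  P_nonneg : ∀ k, 0 ≤ P k
  Q_nonneg : ∀ k, 0 ≤ Q k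
  P_step : ∀ k : ℕ, P (k + 1) ≤ (1 - 7 / 4 * θ / (k + m)) * P k + 4 * K / (θ * (k + m)) * Q k
    + K / (k + m) ^ 2 * (P k + Q k) + ν / (k + m) ^ 2
  Q_step : ∀ k : ℕ, Q (k + 1) ≤ (1 - δ / 2) * Q k + 5 * K / (δ * (k + m) ^ 2) * (P k + Q k)
    + N * ν / (k + m) ^ 2 + D / (δ ^ 2 * (k + m) ^ 4)

namespace EnergyRecursion

variable {θ K ν N δ m D : ℝ} {P Q : ℕ → ℝ}

/-- Since `k + m ≥ 1/δ`, all coupling and forcing terms are `O(δ)`. The contraction is discarded, so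
the bound is useful for `O(1/δ)` steps. -/
lemma crude_step (h : EnergyRecursion θ K ν N δ m D P Q) (hθ : 18 < θ) (hK : 0 ≤ K) (hν : 0 ≤ ν)
    (hN : 0 ≤ N) (hD : 0 ≤ D) (hδ : 0 < δ) (hδ' : δ ≤ 1 / 2) (hm : 16 * θ / δ ≤ m) (k : ℕ) :
    P (k + 1) + Q (k + 1) ≤ (1 + 7 * K * δ) * (P k + Q k) + (ν + N * ν + D) * δ := by
  have hP := h.P_nonneg k
  have hQ := h.Q_nonneg k
  have h1 : 1 / δ ≤ 16 * θ / δ := by gcongr; linarith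
  have ht : 1 / δ ≤ (k : ℝ) + m := by
    have : (0 : ℝ) ≤ k := Nat.cast_nonneg k
    linarith
  have hp := h.P_step k
  have hq := h.Q_step k
  set t := (k : ℝ) + m
  have ht0 : 0 < t := lt_of_lt_of_le (by positivity) ht
  have hi : 1 / t ≤ δ := by rw [div_le_iff₀ ht0]; rwa [div_le_iff₀ hδ, mul_comm] at ht
  have hi0 : 0 < 1 / t := by positivity
  have hi2 : (1 / t) ^ 2 ≤ δ ^ 2 := pow_le_pow_left₀ hi0.le hi 2
  have hi2' : (1 / t) ^ 2 ≤ δ := hi2.trans (by nlinarith)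
  have hi4 : (1 / t) ^ 4 ≤ δ ^ 4 := pow_le_pow_left₀ hi0.le hi 4
  have a1 : (1 - 7 / 4 * θ / t) * P k ≤ 1 * P k := by
    have : 0 ≤ 7 / 4 * θ / t := by positivity
    gcongr; linarith
  have a2 : 4 * K / (θ * t) * Q k ≤ K * δ * Q k := by
    have e : 4 * K / (θ * t) = 4 / θ * K * (1 / t) := by field_simp
    have : 4 / θ ≤ 1 := by rw [div_le_one (by linarith)]; linarith
    rw [e]
    calc 4 / θ * K * (1 / t) * Q k ≤ 1 * K * δ * Q k := by gcongr
      _ = _ := by ring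
  have a3 : K / t ^ 2 * (P k + Q k) ≤ K * δ * (P k + Q k) := by
    have e : K / t ^ 2 = K * (1 / t) ^ 2 := by field_simp
    rw [e]; gcongr
  have a4 : ν / t ^ 2 ≤ ν * δ := by
    have e : ν / t ^ 2 = ν * (1 / t) ^ 2 := by field_simp
    rw [e]; gcongr
  have b1 : (1 - δ / 2) * Q k ≤ 1 * Q k := by gcongr; linarith
  have b2 : 5 * K / (δ * t ^ 2) * (P k + Q k) ≤ 5 * K * δ * (P k + Q k) := by
    have e : 5 * K / (δ * t ^ 2) = 5 * K * ((1 / t) ^ 2 / δ) := by field_simp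
    have : (1 / t) ^ 2 / δ ≤ δ := by rw [div_le_iff₀ hδ, ← sq]; exact hi2
    rw [e]; gcongr
  have b3 : N * ν / t ^ 2 ≤ N * ν * δ := by
    have e : N * ν / t ^ 2 = N * ν * (1 / t) ^ 2 := by field_simp
    rw [e]; gcongr
  have b4 : D / (δ ^ 2 * t ^ 4) ≤ D * δ := by
    have e : D / (δ ^ 2 * t ^ 4) = D * ((1 / t) ^ 4 / δ ^ 2) := by field_simp
    have : (1 / t) ^ 4 / δ ^ 2 ≤ δ := by
      rw [div_le_iff₀ (by positivity)]
      refine hi4.trans ?_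
      nlinarith [pow_pos hδ 3]
    rw [e]; gcongr
  have c1 : 0 ≤ K * δ * P k := by positivity
  linarith

lemma crude_bound (h : EnergyRecursion θ K ν N δ m D P Q) (hθ : 18 < θ) (hK : 0 ≤ K) (hν : 0 ≤ ν)
    (hN : 0 ≤ N) (hD : 0 ≤ D) (hδ : 0 < δ) (hδ' : δ ≤ 1 / 2) (hm : 16 * θ / δ ≤ m) (k : ℕ) :
    P k + Q k ≤ Real.exp (7 * K * (δ * k)) * (P 0 + Q 0 + (ν + N * ν + D) * (δ * k)) := by
  induction k with
  | zero => simp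
  | succ k ih =>
    have h1 := h.crude_step hθ hK hν hN hD hδ hδ' hm k
    have hV : 0 ≤ P 0 + Q 0 := add_nonneg (h.P_nonneg 0) (h.Q_nonneg 0)
    set C := ν + N * ν + D
    have hC : 0 ≤ C := by positivity
    set w := P 0 + Q 0 + C * (δ * k)
    have hw : 0 ≤ w := by positivity
    have e1 : 1 + 7 * K * δ ≤ Real.exp (7 * K * δ) := by
      have := Real.add_one_le_exp (7 * K * δ); linarith
    have e2 : Real.exp (7 * K * (δ * (k + 1 : ℕ))) =
        Real.exp (7 * K * δ) * Real.exp (7 * K * (δ * k)) := by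
      rw [← Real.exp_add]; congr 1; push_cast; ring
    have e3 : 1 ≤ Real.exp (7 * K * (δ * (k + 1 : ℕ))) := Real.one_le_exp (by positivity)
    have e4 : P 0 + Q 0 + C * (δ * (k + 1 : ℕ)) = w + C * δ := by push_cast; ring
    rw [e4, mul_add]
    have f1 : (1 + 7 * K * δ) * (P k + Q k) ≤ Real.exp (7 * K * (δ * (k + 1 : ℕ))) * w := by
      rw [e2, mul_assoc (Real.exp (7 * K * δ))]
      exact mul_le_mul e1 ih (add_nonneg (h.P_nonneg k) (h.Q_nonneg k)) (Real.exp_pos _).le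
    have f2 : C * δ ≤ Real.exp (7 * K * (δ * (k + 1 : ℕ))) * (C * δ) :=
      le_mul_of_one_le_left (by positivity) e3
    linarith

end EnergyRecursion

/-- The rate `7/4 θ/t` is spent as follows: `1/12` absorbs the `K/t²` feedback of `p`, leaving
`5/3`. On `ν/t` this outweighs the noise `ν/t²`. On `(K + 1) H` the surplus `1/6` over `3/2` absorbs
the disagreement terms `2 (K/t) H`; here `θ > 18` gives `2K ≤ (K + 1) θ/6`. -/
lemma mean_bound_step {θ K ν p q t H H' p' : ℝ} (hθ : 18 < θ) (hK : 0 < K)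
    (hν : 0 < ν) (ht : 2 * θ ≤ t) (htK : K ≤ t) (hp0 : 0 ≤ p) (hq0 : 0 ≤ q)
    (hp : p ≤ ν / t + (K + 1) * H) (hq : q ≤ H) (hH : (1 - 3 / 2 * θ / t) * H ≤ H')
    (hstep : p' ≤ (1 - 7 / 4 * θ / t) * p + 4 * K / (θ * t) * q
      + K / t ^ 2 * (p + q) + ν / t ^ 2) :
    p' ≤ ν / (t + 1) + (K + 1) * H' := by
  have ht0 : 0 < t := by linarith
  have hH0 : 0 ≤ H := hq0.trans hq
  obtain ⟨u, hu⟩ : ∃ u, u = 1 / t := ⟨_, rfl⟩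
  have hu0 : 0 < u := by rw [hu]; positivity
  have hut : u * t = 1 := by rw [hu]; field_simp
  have hθu : θ * u ≤ 1 / 2 := by nlinarith
  have hu1 : u ≤ 1 := by nlinarith
  have hKu : K * u ≤ 1 := by nlinarith
  have e1 : 7 / 4 * θ / t = 7 / 4 * (θ * u) := by rw [hu]; field_simp
  have e2 : 4 * K / (θ * t) = 4 / θ * (K * u) := by rw [hu]; field_simp
  have e3 : K / t ^ 2 = K * u * u := by rw [hu]; field_simp
  have e4 : ν / t ^ 2 = ν * u ^ 2 := by rw [hu]; field_simp
  have e5 : 3 / 2 * θ / t = 3 / 2 * (θ * u) := by rw [hu]; field_simp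
  have e6 : ν / t = ν * u := by rw [hu]; field_simp
  rw [e1, e2, e3, e4] at hstep
  rw [e5] at hH
  rw [e6] at hp
  have a1 : K * u * u * p ≤ 1 / 12 * (θ * u) * p := by
    have : K * u * u ≤ 1 / 12 * (θ * u) := by nlinarith
    gcongr
  have a2 : 4 / θ * (K * u) * q ≤ K * u * q := by
    have : 4 / θ ≤ 1 := by rw [div_le_one (by linarith)]; linarith
    have h := mul_le_mul_of_nonneg_right this (by positivity : 0 ≤ K * u * q)
    linarith
  have a3 : K * u * u * q ≤ K * u * q := by
    have : K * u * u ≤ K * u := mul_le_of_le_one_right (by positivity) hu1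
    gcongr
  have b1 : p' ≤ (1 - 5 / 3 * (θ * u)) * p + 2 * (K * u) * q + ν * u ^ 2 := by linarith
  have b2 : (1 - 5 / 3 * (θ * u)) * p ≤ (1 - 5 / 3 * (θ * u)) * (ν * u + (K + 1) * H) :=
    mul_le_mul_of_nonneg_left hp (by linarith)
  have b3 : 2 * (K * u) * q ≤ 2 * (K * u) * H := by gcongr
  have b4 : u - u ^ 2 ≤ 1 / (t + 1) := by
    rw [hu, le_div_iff₀ (by positivity)]
    have : (1 / t - (1 / t) ^ 2) * (t + 1) = 1 - (1 / t) ^ 2 := by field_simp; ring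
    rw [this]; nlinarith [sq_nonneg (1 / t)]
  have b5 : ν * (u - u ^ 2) ≤ ν / (t + 1) := by
    have := mul_le_mul_of_nonneg_left b4 hν.le
    rwa [mul_one_div] at this
  have b6 : (K + 1) * ((1 - 3 / 2 * (θ * u)) * H) ≤ (K + 1) * H' :=
    mul_le_mul_of_nonneg_left hH (by linarith)
  have b7 : ν * u ^ 2 * 2 ≤ 5 / 3 * θ * (ν * u ^ 2) := by
    have h0 : 0 ≤ ν * u ^ 2 := by positivity
    have := mul_le_mul_of_nonneg_right (by linarith : 2 ≤ 5 / 3 * θ) h0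
    linarith
  have b8 : 2 * (K * u) * H ≤ (K + 1) * (1 / 6 * (θ * u) * H) := by
    have h1 : 0 ≤ u * H := by positivity
    have h2 : 2 * K ≤ (K + 1) * (1 / 6 * θ) := by
      have := mul_le_mul_of_nonneg_left (by linarith : 3 ≤ 1 / 6 * θ) (by linarith : 0 ≤ K + 1)
      linarith
    have := mul_le_mul_of_nonneg_right h2 h1
    linarith
  linarith

/-- The contraction `δ/2` is divided into `δ/8` for the feedback through `(K + 2) H` (`a4`, where
`T` must be large), `δ/4` for the forcing (`a5`, whence the factors `4` in `hHD`), and `δ/8` for the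
decay of `H` itself (`a6`). -/
lemma gap_bound_step {θ K ν N δ T D p q t H H' q' : ℝ} (hK : 0 < K)
    (hN : 1 ≤ N) (hδ : 0 < δ) (hδ' : δ ≤ 1 / 2) (hT : 1 ≤ T) (hTK : 40 * K * (K + 2) ≤ T)
    (ht : 16 * θ / δ ≤ t) (htT : T / δ ≤ t)
    (hν : 0 < ν) (hp : p ≤ ν / t + (K + 1) * H) (hq0 : 0 ≤ q) (hq : q ≤ H)
    (hH : (1 - 3 / 2 * θ / t) * H ≤ H')
    (hHD : 4 * ν * (5 * K + 1) * N / (δ * t ^ 2) + 4 * D / (δ ^ 3 * t ^ 4) ≤ H)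
    (hstep : q' ≤ (1 - δ / 2) * q + 5 * K / (δ * t ^ 2) * (p + q)
      + N * ν / t ^ 2 + D / (δ ^ 2 * t ^ 4)) : q' ≤ H' := by
  have ht0 : 0 < t := lt_of_lt_of_le (by positivity) htT
  have hH0 : 0 ≤ H := hq0.trans hq
  rw [div_le_iff₀ hδ] at ht htT
  have a1 : (1 - δ / 2) * q ≤ (1 - δ / 2) * H := by gcongr; linarith
  have a2 : 5 * K / (δ * t ^ 2) * (p + q) ≤
      5 * K / (δ * t ^ 2) * (ν / t) + 5 * K / (δ * t ^ 2) * ((K + 2) * H) := by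
    rw [← mul_add]
    exact mul_le_mul_of_nonneg_left (by linarith) (by positivity)
  have a3 : 5 * K / (δ * t ^ 2) * (ν / t) ≤ 5 * K * (ν * N / t ^ 2) := by
    have e : 5 * K / (δ * t ^ 2) * (ν / t) = 5 * K * (ν * (1 / (t * δ)) / t ^ 2) := by
      field_simp
    have h1 : 1 / (t * δ) ≤ N := by
      rw [div_le_iff₀ (by positivity)]; nlinarith
    rw [e]; gcongr
  have a4 : 5 * K / (δ * t ^ 2) * ((K + 2) * H) ≤ δ / 8 * H := by
    rw [← mul_assoc]
    refine mul_le_mul_of_nonneg_right ?_ hH0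
    rw [div_mul_eq_mul_div, div_le_iff₀ (by positivity)]
    have : T ≤ (t * δ) ^ 2 := by nlinarith
    nlinarith
  have a5 : δ / 4 * (4 * ν * (5 * K + 1) * N / (δ * t ^ 2) + 4 * D / (δ ^ 3 * t ^ 4)) ≤
      δ / 4 * H := by gcongr
  have e5 : δ / 4 * (4 * ν * (5 * K + 1) * N / (δ * t ^ 2) + 4 * D / (δ ^ 3 * t ^ 4)) =
      5 * K * (ν * N / t ^ 2) + N * ν / t ^ 2 + D / (δ ^ 2 * t ^ 4) := by
    field_simp
  have a6 : 3 / 2 * θ / t ≤ δ / 8 := by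
    rw [div_le_iff₀ ht0]; linarith
  have a7 : (1 - δ / 8) * H ≤ (1 - 3 / 2 * θ / t) * H := by gcongr
  linarith

/-- For `k ≥ B N / δ`, the comparison function is at most of order `1 / k`. -/
lemma gapBound_le {N δ b c E t₀ M₁ c₃ q r B k t : ℝ} (hN : 1 ≤ N) (hδ : 0 < δ) (hb : 0 ≤ b)
    (hc : 0 ≤ c) (hE : 0 ≤ E) (ht₀ : 0 ≤ t₀) (ht₀' : t₀ ≤ M₁ / δ) (hM₁ : 0 < M₁)
    (hgap : 1 / δ ≤ c₃ * N ^ q) (hr : 2 ≤ r) (hq : 4 + q ≤ r)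
    (hB : 1 ≤ B) (hBc : c ≤ B) (hBM : M₁ ≤ B) (hBE : E * M₁ ^ 2 * c₃ ≤ B)
    (hk : B * N / δ ≤ k) (hkt : k ≤ t) :
    gapBound N δ b c (E * N ^ 3) t₀ r t ≤ (b + 2) / k := by
  have hN0 : 0 < N := by linarith
  have hB0 : 0 < B := by linarith
  have hk0 : 0 < k := lt_of_lt_of_le (by positivity) hk
  have ht0 : 0 < t := hk0.trans_le hkt
  have hc₃ : 0 < c₃ := by
    by_contra! h
    have h1 : 0 < 1 / δ := by positivity
    have h2 : c₃ * N ^ q ≤ 0 := mul_nonpos_of_nonpos_of_nonneg h (by positivity)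
    linarith
  -- `w = N / (δ k)` is at most `1 / B`
  obtain ⟨w, hw⟩ : ∃ w, w = N / (δ * k) := ⟨_, rfl⟩
  have hw0 : 0 < w := by rw [hw]; positivity
  have hwB : w * B ≤ 1 := by
    rw [div_le_iff₀ hδ] at hk
    rw [hw, div_mul_eq_mul_div, div_le_one (by positivity)]; linarith
  have hw1 : w ≤ 1 := by nlinarith
  have t1 : b * N / (δ * t ^ 2) ≤ b / k := by
    calc b * N / (δ * t ^ 2) ≤ b * N / (δ * k ^ 2) := by gcongr
      _ = b * w / k := by rw [hw]; field_simp
      _ ≤ b * 1 / k := by gcongr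
      _ = b / k := by rw [mul_one]
  have t2 : c * N ^ 3 / (δ ^ 3 * t ^ 4) ≤ 1 / k := by
    calc c * N ^ 3 / (δ ^ 3 * t ^ 4) ≤ c * N ^ 3 / (δ ^ 3 * k ^ 4) := by gcongr
      _ = c * w ^ 3 / k := by rw [hw]; field_simp
      _ ≤ B * w / k := by
          have : w ^ 3 ≤ w := pow_le_of_le_one hw0.le hw1 (by norm_num)
          gcongr
      _ ≤ 1 / k := by gcongr; linarith
  -- One factor of `(t₀/t)^r` supplies `1/k`, at the price `M₁/δ ≤ M₁ c₃ N^q`. The other `r - 1`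
  -- supply `N^(1 - r)`, and `4 + q ≤ r` makes the total power of `N` nonpositive.
  have t3 : E * N ^ 3 * (t₀ / t) ^ r ≤ 1 / k := by
    have h1 : (t₀ / t) ^ r ≤ (M₁ / δ / k) ^ r := by
      refine Real.rpow_le_rpow (by positivity) ?_ (by linarith)
      gcongr
    have e1 : M₁ / δ / k = M₁ * w / N := by rw [hw]; field_simp
    have hx0 : 0 < M₁ * w / N := by positivity
    have h2 : (M₁ * w / N) ^ r = (M₁ * w / N) ^ (r - 1) * (M₁ / δ / k) := by
      rw [e1, ← Real.rpow_add_one hx0.ne', sub_add_cancel]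
    have h3 : (M₁ * w / N) ^ (r - 1) ≤ (M₁ / B) * N ^ (1 - r) := by
      rw [Real.div_rpow (by positivity) hN0.le, div_eq_mul_inv, ← Real.rpow_neg hN0.le, neg_sub]
      refine mul_le_mul_of_nonneg_right ?_ (by positivity)
      have hMw : M₁ * w ≤ M₁ / B := by
        rw [le_div_iff₀ hB0, mul_assoc]; exact mul_le_of_le_one_right hM₁.le hwB
      have hMB : M₁ / B ≤ 1 := by rw [div_le_one hB0]; exact hBM
      calc (M₁ * w) ^ (r - 1) ≤ (M₁ * w) ^ (1 : ℝ) :=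
            Real.rpow_le_rpow_of_exponent_ge (by positivity) (hMw.trans hMB) (by linarith)
        _ ≤ M₁ / B := by rw [Real.rpow_one]; exact hMw
    have h4 : N ^ 3 * N ^ (1 - r) * N ^ q ≤ 1 := by
      rw [← Real.rpow_natCast, ← Real.rpow_add hN0, ← Real.rpow_add hN0]
      exact Real.rpow_le_one_of_one_le_of_nonpos hN (by push_cast; linarith)
    rw [e1, h2] at h1
    calc E * N ^ 3 * (t₀ / t) ^ r
        ≤ E * N ^ 3 * ((M₁ / B) * N ^ (1 - r) * (M₁ / δ / k)) := by
          gcongr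
          exact h1.trans (by gcongr)
      _ = E * M₁ ^ 2 / B * (N ^ 3 * N ^ (1 - r)) * (1 / δ) / k := by field_simp
      _ ≤ E * M₁ ^ 2 / B * (N ^ 3 * N ^ (1 - r)) * (c₃ * N ^ q) / k := by gcongr
      _ = (E * M₁ ^ 2 * c₃) / B * (N ^ 3 * N ^ (1 - r) * N ^ q) / k := by ring
      _ ≤ 1 * 1 / k := by
          gcongr
          rw [div_le_one hB0]; exact hBE
      _ = 1 / k := by rw [mul_one]
  unfold gapBound
  rw [add_div]
  have : (2 : ℝ) / k = 1 / k + 1 / k := by ring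
  linarith

/-- The two bounds need each other, so they are proved by one induction, started at `k₀` where the
last term of `gapBound` equals `V`. -/
lemma EnergyRecursion.bound {θ K ν N δ m D T V t₀ : ℝ} {P Q : ℕ → ℝ}
    (h : EnergyRecursion θ K ν N δ m D P Q) (hθ : 18 < θ) (hK : 0 < K) (hν : 0 < ν) (hN : 1 ≤ N)
    (hδ : 0 < δ) (hδ' : δ ≤ 1 / 2) (hm : 16 * θ / δ ≤ m)
    (hT : 1 ≤ T) (hTK : 40 * K * (K + 2) ≤ T) {k₀ : ℕ} (hk₀ : T / δ ≤ k₀) (ht₀ : t₀ = k₀ + m)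
    (hV : P k₀ + Q k₀ ≤ V) {c : ℝ} (hDc : 4 * D ≤ c * N ^ 3) (hc : 0 ≤ c) {k : ℕ} (hk : k₀ ≤ k) :
    P k ≤ ν / (k + m) +
        (K + 1) * gapBound N δ (4 * ν * (5 * K + 1)) c V t₀ (3 / 2 * θ) (k + m) ∧
      Q k ≤ gapBound N δ (4 * ν * (5 * K + 1)) c V t₀ (3 / 2 * θ) (k + m) := by
  have hm0 : 0 < m := lt_of_lt_of_le (by positivity) hm
  have ht₀0 : 0 < t₀ := by rw [ht₀]; positivity
  have hP0 := h.P_nonneg k₀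
  have hQ0 := h.Q_nonneg k₀
  have hV0 : 0 ≤ V := by linarith
  induction k, hk using Nat.le_induction with
  | base =>
    rw [← ht₀]
    have h1 : V ≤ gapBound N δ (4 * ν * (5 * K + 1)) c V t₀ (3 / 2 * θ) t₀ := by
      unfold gapBound
      rw [div_self ht₀0.ne', Real.one_rpow, mul_one]
      have : 0 ≤ 4 * ν * (5 * K + 1) * N / (δ * t₀ ^ 2) := by positivity
      have : 0 ≤ c * N ^ 3 / (δ ^ 3 * t₀ ^ 4) := by positivity
      linarith
    set H := gapBound N δ (4 * ν * (5 * K + 1)) c V t₀ (3 / 2 * θ) t₀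
    have h2 : 0 ≤ ν / t₀ := by positivity
    have h3 : 0 ≤ K * H := mul_nonneg hK.le (by linarith)
    constructor <;> linarith
  | succ k hk ih =>
    have hkk : (k₀ : ℝ) ≤ k := by exact_mod_cast hk
    have hk0 : (0 : ℝ) ≤ k₀ := Nat.cast_nonneg _
    have htm : 16 * θ / δ ≤ (k : ℝ) + m := by linarith
    have htT : T / δ ≤ (k : ℝ) + m := by linarith
    have ht2 : 2 * θ ≤ (k : ℝ) + m := by
      refine le_trans ?_ htm
      rw [le_div_iff₀ hδ]; nlinarith
    have htK : K ≤ (k : ℝ) + m := by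
      refine le_trans ?_ htT
      rw [le_div_iff₀ hδ]; nlinarith
    have hp := h.P_step k
    have hq := h.Q_step k
    have hPk := h.P_nonneg k
    have hQk := h.Q_nonneg k
    have et : ((k + 1 : ℕ) : ℝ) + m = (k + m) + 1 := by push_cast; ring
    rw [et]
    set t := (k : ℝ) + m
    have ht0 : 0 < t := by linarith
    have hH := gapBound_step (N := N) (δ := δ) (b := 4 * ν * (5 * K + 1)) (c := c) (e := V)
      (t₀ := t₀) (r := 3 / 2 * θ) (by linarith) hδ (by positivity) hc hV0 ht₀0.le (by linarith) ht0
    refine ⟨mean_bound_step hθ hK hν ht2 htK hPk hQk ih.1 ih.2 hH hp,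
      gap_bound_step hK hN hδ hδ' hT hTK htm htT hν ih.1 hQk ih.2 hH ?_ hq⟩
    unfold gapBound
    have h1 : 4 * D / (δ ^ 3 * t ^ 4) ≤ c * N ^ 3 / (δ ^ 3 * t ^ 4) := by gcongr
    have h2 : 0 ≤ V * (t₀ / t) ^ (3 / 2 * θ) := by positivity
    linarith

theorem exists_rate_of_energyRecursion (θ K ν M : ℝ) (hθ : 18 < θ) (hK : 0 < K) (hν : 0 < ν)
    (hM : 0 < M) : ∃ A : ℝ, 0 < A ∧ ∀ C c₃ q : ℝ, 0 < C → 0 < c₃ → q ≤ 4 * θ / 3 - 1 →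
      ∃ B : ℝ, 1 ≤ B ∧ ∀ (N δ m D : ℝ) (P Q : ℕ → ℝ), 1 ≤ N → 0 < δ → δ ≤ 1 / 2 →
        16 * θ / δ ≤ m → m ≤ M / δ → 1 / δ ≤ c₃ * N ^ q → 0 ≤ D → D ≤ C * N ^ 3 →
        P 0 + Q 0 ≤ C * N ^ 3 → EnergyRecursion θ K ν N δ m D P Q →
        ∀ k : ℕ, B * N / δ ≤ k → P k + Q k ≤ A / k := by
  -- The `2` counts the two terms of `gapBound` that involve the data `C`, `c₃`, `q`; each is at
  -- most `1/k` once `B` is large, so the rate constant is chosen before these data.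
  refine ⟨ν + (K + 2) * (4 * ν * (5 * K + 1) + 2), by positivity, fun C c₃ q hC hc₃ hq => ?_⟩
  obtain ⟨T, hTdef⟩ : ∃ T : ℝ, T = 40 * K * (K + 2) + 1 := ⟨_, rfl⟩
  have hT : 1 ≤ T := by
    have : 0 < 40 * K * (K + 2) := by positivity
    linarith
  obtain ⟨E, hE⟩ : ∃ E : ℝ, E = Real.exp (7 * K * (T + 1)) * (C + (2 * ν + C) * (T + 1)) :=
    ⟨_, rfl⟩
  have hE0 : 0 < E := by rw [hE]; positivity
  obtain ⟨M₁, hM₁⟩ : ∃ M₁ : ℝ, M₁ = T + 1 + M := ⟨_, rfl⟩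
  have hM₁0 : 0 < M₁ := by linarith
  -- One summand for each lower bound on `B` in `gapBound_le`. Here `M₁/δ` bounds `k₀ + m`, and `E
  -- N³` bounds the energy at `k₀`, the end of the crude phase.
  refine ⟨M₁ + 4 * C + E * M₁ ^ 2 * c₃, ?_, ?_⟩
  · have : 0 < 4 * C + E * M₁ ^ 2 * c₃ := by positivity
    linarith
  intro N δ m D P Q hN hδ hδ' hm hmM hgap hD hDC h0 h k hk
  obtain ⟨B, hB⟩ : ∃ B, B = M₁ + 4 * C + E * M₁ ^ 2 * c₃ := ⟨_, rfl⟩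
  rw [← hB] at hk
  have hE1 : 0 < E * M₁ ^ 2 * c₃ := by positivity
  have hN0 : 0 < N := by linarith
  obtain ⟨k₀, hk₀1, h1⟩ : ∃ k₀ : ℕ, T / δ ≤ k₀ ∧ (k₀ : ℝ) ≤ T / δ + 1 :=
    ⟨_, Nat.le_ceil _, (Nat.ceil_lt_add_one (by positivity : 0 ≤ T / δ)).le⟩
  have hk₀2 : (k₀ : ℝ) ≤ (T + 1) / δ := by
    have h2 : 1 ≤ 1 / δ := by rw [le_div_iff₀ hδ]; linarith
    rw [add_div]; linarith
  have hδk : δ * k₀ ≤ T + 1 := by rw [le_div_iff₀ hδ] at hk₀2; linarith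
  have hV : P k₀ + Q k₀ ≤ E * N ^ 3 := by
    refine (h.crude_bound hθ hK.le hν.le hN0.le hD hδ hδ' hm k₀).trans ?_
    have hN3 : N ≤ N ^ 3 := le_self_pow₀ hN (by norm_num)
    have hN4 : 1 ≤ N ^ 3 := one_le_pow₀ hN
    have h1 : ν + N * ν + D ≤ (2 * ν + C) * N ^ 3 := by nlinarith
    have hc0 : 0 ≤ ν + N * ν + D := by positivity
    calc Real.exp (7 * K * (δ * k₀)) * (P 0 + Q 0 + (ν + N * ν + D) * (δ * k₀))
        ≤ Real.exp (7 * K * (T + 1)) * (C * N ^ 3 + (2 * ν + C) * N ^ 3 * (T + 1)) := by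
          have := h.P_nonneg 0
          have := h.Q_nonneg 0
          gcongr
      _ = E * N ^ 3 := by rw [hE]; ring
  have hkk₀ : k₀ ≤ k := by
    have : (k₀ : ℝ) ≤ k := by
      refine (hk₀2.trans ?_).trans hk
      gcongr
      nlinarith
    exact_mod_cast this
  obtain ⟨h1, h2⟩ := h.bound hθ hK hν hN hδ hδ' hm hT (by linarith) hk₀1 rfl hV
    (c := 4 * C) (by nlinarith [pow_pos hN0 3]) (by positivity) hkk₀
  have hm0 : 0 < m := lt_of_lt_of_le (by positivity) hm
  have hB0 : 0 < B := by linarith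
  have hk0 : 0 < (k : ℝ) := lt_of_lt_of_le (by positivity) hk
  -- The exponent condition reads `4 + q ≤ 3θ/2`; it follows from `q ≤ 4θ/3 - 1` and `θ > 18`.
  have h3 := gapBound_le (b := 4 * ν * (5 * K + 1)) (c := 4 * C) (E := E) (t₀ := k₀ + m)
    (M₁ := M₁) (c₃ := c₃) (q := q) (r := 3 / 2 * θ) (B := B) (k := k) (t := k + m) hN hδ
    (by positivity) (by positivity) hE0.le (by linarith)
    (by rw [hM₁, add_div]; exact add_le_add hk₀2 hmM) hM₁0 hgap (by linarith)
    (by linarith) (by linarith) (by linarith) (by linarith) (by linarith) hk (by linarith)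
  have h4 : ν / (k + m) ≤ ν / k := by gcongr; linarith
  have h5 := mul_le_mul_of_nonneg_left h3 (by linarith : 0 ≤ K + 2)
  calc P k + Q k ≤ ν / k + (K + 2) * ((4 * ν * (5 * K + 1) + 2) / k) := by linarith
    _ = _ := by ring

/-! ### Square integrable random vectors, independence and centred noise. -/

section SquareIntegrable

variable {Ω E : Type*} [MeasurableSpace Ω] [NormedAddCommGroup E] [InnerProductSpace ℝ E]

/-- The space of square integrable functions, before passing to classes. -/
def squareIntegrable (E : Type*) [NormedAddCommGroup E] [InnerProductSpace ℝ E] (P : Measure Ω) :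
    Submodule ℝ (Ω → E) where
  carrier := {X | MemLp X 2 P}
  add_mem' hX hY := MemLp.add hX hY
  zero_mem' := MemLp.zero
  smul_mem' c _ hX := MemLp.const_smul hX c

/-- The class in `L²` of a square integrable function. -/
noncomputable def toL2 (P : Measure Ω) : squareIntegrable E P →ₗ[ℝ] Lp E 2 P where
  toFun X := MemLp.toLp X.1 X.2
  map_add' X Y := MemLp.toLp_add X.2 Y.2
  map_smul' c X := MemLp.toLp_const_smul c X.2

variable {P : Measure Ω}

lemma coeFn_toL2 (X : squareIntegrable E P) : toL2 P X =ᵐ[P] X.1 := MemLp.coeFn_toLp X.2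

lemma inner_toL2 (X Y : squareIntegrable E P) :
    inner ℝ (toL2 P X) (toL2 P Y) = ∫ ω, inner ℝ (X.1 ω) (Y.1 ω) ∂P := by
  rw [L2.inner_def]
  refine integral_congr_ae ?_
  filter_upwards [coeFn_toL2 X, coeFn_toL2 Y] with ω h1 h2
  rw [h1, h2]

lemma norm_sq_toL2 (X : squareIntegrable E P) : ‖toL2 P X‖ ^ 2 = ∫ ω, ‖X.1 ω‖ ^ 2 ∂P := by
  rw [← real_inner_self_eq_norm_sq, inner_toL2]
  simp only [real_inner_self_eq_norm_sq]

lemma norm_toL2_le {X Y : squareIntegrable E P} {L : ℝ} (h : ∀ ω, ‖X.1 ω‖ ≤ L * ‖Y.1 ω‖) :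
    ‖toL2 P X‖ ≤ L * ‖toL2 P Y‖ := by
  refine Lp.norm_le_mul_norm_of_ae_le_mul ?_
  filter_upwards [coeFn_toL2 X, coeFn_toL2 Y] with ω h1 h2
  rw [h1, h2]
  exact h ω

lemma integrable_inner_of_memLp {X Y : Ω → E} (hX : MemLp X 2 P) (hY : MemLp Y 2 P) :
    Integrable (fun ω => (inner ℝ (X ω) (Y ω) : ℝ)) P := by
  refine (L2.integrable_inner (𝕜 := ℝ) (hX.toLp X) (hY.toLp Y)).congr ?_
  filter_upwards [hX.coeFn_toLp, hY.coeFn_toLp] with ω h1 h2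
  rw [h1, h2]

end SquareIntegrable

lemma measurable_of_mem_compl {ι Ω Ξ : Type*} [MeasurableSpace Ξ] (ξ : ι → Ω → Ξ) {a b : ι} (hab : b ≠ a) :
    Measurable[⨆ b ∈ ({a}ᶜ : Set ι), MeasurableSpace.comap (ξ b) inferInstance] (ξ b) :=
  Measurable.mono (comap_measurable (ξ b))
    (le_iSup₂_of_le (f := fun b (_ : b ∈ ({a}ᶜ : Set ι)) =>
      MeasurableSpace.comap (ξ b) inferInstance) b hab le_rfl) le_rfl

/-- Grouping of independent families: the sample `a` against all the others. -/
lemma indepFun_of_measurable_compl {ι Ω Ξ β : Type*} [MeasurableSpace Ω] [MeasurableSpace Ξ]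
    [MeasurableSpace β] {P : Measure Ω} {ξ : ι → Ω → Ξ}
    (hξ : ∀ a, Measurable (ξ a)) (hind : iIndepFun ξ P) (a : ι) {V : Ω → β}
    (hV : Measurable[⨆ b ∈ ({a}ᶜ : Set ι), MeasurableSpace.comap (ξ b) inferInstance] V) :
    IndepFun V (ξ a) P := by
  rw [IndepFun_iff_Indep]
  have h := indep_iSup_of_disjoint (fun b => (hξ b).comap_le)
    ((iIndepFun_iff_iIndep _ _ _).1 hind) (disjoint_compl_left : Disjoint ({a}ᶜ : Set ι) {a})
  refine indep_of_indep_of_le_right (indep_of_indep_of_le_left h hV.comap_le) ?_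
  exact le_iSup₂_of_le a rfl le_rfl

section Noise

variable {Ω Ξ E : Type*} [MeasurableSpace Ω] [MeasurableSpace Ξ] [NormedAddCommGroup E]
  [InnerProductSpace ℝ E] [CompleteSpace E] [MeasurableSpace E] [BorelSpace E]
  [SecondCountableTopology E] {P : Measure Ω} [IsProbabilityMeasure P]

/-- If the noise `e (X, ξ)` has zero mean given `X`, and `ξ` is independent of `X`, then the mean of
`e (x, ξ)` vanishes for almost every value `x` of `X`. -/
lemma ae_integral_noise_eq_zero {X : Ω → E} {ξ : Ω → Ξ} (hX : Measurable X) (hξ : Measurable ξ)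
    (hind : IndepFun X ξ P) {e : E × Ξ → E} (he : Measurable e)
    (hint : Integrable (fun ω => e (X ω, ξ ω)) P)
    (hcond : P[fun ω => e (X ω, ξ ω) | MeasurableSpace.comap X inferInstance] =ᵐ[P] 0) :
    ∀ᵐ x ∂(P.map X), ∫ s, e (x, s) ∂(P.map ξ) = 0 := by
  have hmap := (indepFun_iff_map_prod_eq_prod_map_map hX.aemeasurable hξ.aemeasurable).1 hind
  have : IsProbabilityMeasure (P.map X) := Measure.isProbabilityMeasure_map hX.aemeasurable
  have : IsProbabilityMeasure (P.map ξ) := Measure.isProbabilityMeasure_map hξ.aemeasurable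
  have hpair : Measurable fun ω => (X ω, ξ ω) := hX.prodMk hξ
  have hintp : Integrable e ((P.map X).prod (P.map ξ)) := by
    rw [← hmap]
    exact (integrable_map_measure he.aestronglyMeasurable hpair.aemeasurable).2 hint
  refine Integrable.ae_eq_zero_of_forall_setIntegral_eq_zero hintp.integral_prod_left ?_
  intro A hA _
  -- Over `A × univ` the product integral is the integral of the noise on the event `X ∈ A`, where
  -- the conditional mean applies.
  have h1 : ∫ x in A, ∫ s, e (x, s) ∂(P.map ξ) ∂(P.map X) =
      ∫ z in A ×ˢ Set.univ, e z ∂((P.map X).prod (P.map ξ)) := by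
    rw [setIntegral_prod _ hintp.integrableOn]
    simp
  rw [h1, ← hmap, setIntegral_map (hA.prod MeasurableSet.univ) he.aestronglyMeasurable
    hpair.aemeasurable]
  have h2 : (fun ω => (X ω, ξ ω)) ⁻¹' (A ×ˢ Set.univ) = X ⁻¹' A := by ext; simp
  rw [h2, ← setIntegral_condExp hX.comap_le hint ⟨A, hA, rfl⟩]
  exact setIntegral_eq_zero_of_ae_eq_zero (hcond.mono fun ω h _ => h)

/-- `Z` need not be a function of `X`, so conditioning on `X` does not suffice. Independence of `ξ`
from the pair allows Fubini with the sample integrated first; the inner integral is `⟨Z, 0⟩` by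
`ae_integral_noise_eq_zero`. -/
lemma integral_inner_noise_eq_zero {X Z : Ω → E} {ξ : Ω → Ξ} (hX : Measurable X)
    (hZ : Measurable Z) (hξ : Measurable ξ) (hind : IndepFun (fun ω => (X ω, Z ω)) ξ P)
    {e : E × Ξ → E} (he : Measurable e) (he2 : MemLp (fun ω => e (X ω, ξ ω)) 2 P)
    (hZ2 : MemLp Z 2 P)
    (hcond : P[fun ω => e (X ω, ξ ω) | MeasurableSpace.comap X inferInstance] =ᵐ[P] 0) :
    ∫ ω, inner ℝ (Z ω) (e (X ω, ξ ω)) ∂P = 0 := by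
  have hXZ : Measurable fun ω => (X ω, Z ω) := hX.prodMk hZ
  have hmap := (indepFun_iff_map_prod_eq_prod_map_map hXZ.aemeasurable hξ.aemeasurable).1 hind
  have : IsProbabilityMeasure (P.map fun ω => (X ω, Z ω)) :=
    Measure.isProbabilityMeasure_map hXZ.aemeasurable
  have : IsProbabilityMeasure (P.map ξ) := Measure.isProbabilityMeasure_map hξ.aemeasurable
  have hint := he2.integrable (by norm_num)
  have hzero := ae_integral_noise_eq_zero hX hξ (hind.comp measurable_fst measurable_id) he hint
    hcond
  have hpair : Measurable fun ω => ((X ω, Z ω), ξ ω) := hXZ.prodMk hξ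
  have he' : Measurable fun w : (E × E) × Ξ => e (w.1.1, w.2) := he.comp (by fun_prop)
  have hF : Measurable fun w : (E × E) × Ξ => (inner ℝ w.1.2 (e (w.1.1, w.2)) : ℝ) :=
    (by fun_prop : Measurable fun w : (E × E) × Ξ => w.1.2).inner he'
  have hintF : Integrable (fun w : (E × E) × Ξ => (inner ℝ w.1.2 (e (w.1.1, w.2)) : ℝ))
      ((P.map fun ω => (X ω, Z ω)).prod (P.map ξ)) := by
    rw [← hmap]
    exact (integrable_map_measure hF.aestronglyMeasurable hpair.aemeasurable).2
      (integrable_inner_of_memLp hZ2 he2)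
  have hinte : Integrable (fun w : (E × E) × Ξ => e (w.1.1, w.2))
      ((P.map fun ω => (X ω, Z ω)).prod (P.map ξ)) := by
    rw [← hmap]
    exact (integrable_map_measure he'.aestronglyMeasurable hpair.aemeasurable).2 hint
  have h1 : ∫ ω, inner ℝ (Z ω) (e (X ω, ξ ω)) ∂P =
      ∫ w, (inner ℝ w.1.2 (e (w.1.1, w.2)) : ℝ)
        ∂((P.map fun ω => (X ω, Z ω)).prod (P.map ξ)) := by
    rw [← hmap, integral_map hpair.aemeasurable hF.aestronglyMeasurable]
  rw [h1, integral_prod _ hintF]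
  have hzero' : ∀ᵐ v ∂(P.map fun ω => (X ω, Z ω)), ∫ s, e (v.1, s) ∂(P.map ξ) = 0 := by
    have hfst : P.map X = (P.map fun ω => (X ω, Z ω)).map Prod.fst := by
      rw [Measure.map_map measurable_fst hXZ]; rfl
    rw [hfst] at hzero
    exact ae_of_ae_map measurable_fst.aemeasurable hzero
  refine integral_eq_zero_of_ae ?_
  filter_upwards [hzero', hinte.prod_right_ae] with v hv hvi
  rw [integral_inner hvi, hv, inner_zero_right]
  rfl

lemma condExp_noise_eq_zero {X : Ω → E} {γ G : Ω → E} {φ : E → E} (hX : Measurable X)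
    (hφ : Measurable φ) (hG : G = fun ω => φ (X ω)) (hγ2 : Integrable γ P) (hG2 : Integrable G P)
    (hcond : P[γ | MeasurableSpace.comap X inferInstance] =ᵐ[P] G) :
    P[fun ω => γ ω - G ω | MeasurableSpace.comap X inferInstance] =ᵐ[P] 0 := by
  have h1 : P[G | MeasurableSpace.comap X inferInstance] = G :=
    condExp_of_stronglyMeasurable hX.comap_le
      (by rw [hG]; exact (hφ.comp (comap_measurable X)).stronglyMeasurable) hG2
  have h2 := condExp_sub hγ2 hG2 (MeasurableSpace.comap X inferInstance)
  rw [h1] at h2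
  filter_upwards [h2, hcond] with ω a b
  change (P[γ - G | MeasurableSpace.comap X inferInstance]) ω = 0
  rw [a, Pi.sub_apply, b, sub_self]

end Noise

/-! ### The uncompressed recursion and its measurability. -/

section Algorithm

variable {n p : ℕ} {Ξ : Type*}

section Recursion

variable (W : Matrix (Fin n) (Fin n) ℝ) (θ μ L lam2 : ℝ) (g : Fin n → Vec p → Ξ → Vec p)
  (xinit hinit : Fin n → Vec p) (z : ℕ → Fin n → Ξ)

lemma cedasState_hw (k : ℕ) (i : Fin n) :
    (cedasState (uncompressedParams p W θ μ L lam2) g xinit hinit z k).hw i =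
      ∑ j, W i j • (cedasState (uncompressedParams p W θ μ L lam2) g xinit hinit z k).h j := by
  induction k with
  | zero => rfl
  | succ k ih =>
    simp only [cedasState, cedasStep, uncompressedParams, id, sub_self, zero_smul, zero_add,
      one_smul] at ih ⊢
    rw [ih, ← Finset.sum_add_distrib]
    exact Finset.sum_congr rfl fun j _ => by rw [← smul_add]

/-- The point `y_{i,k}` sent by agent `i`. -/
noncomputable def cedasMessage (k : ℕ) (i : Fin n) : Vec p :=
  let s := cedasState (uncompressedParams p W θ μ L lam2) g xinit hinit z k
  s.x i - decreasingStepsize θ μ (stepsizeOffset θ μ L lam2) k • g i (s.x i) (z (k + 1) i) - s.d i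

lemma cedasState_d_succ (k : ℕ) (i : Fin n) :
    (cedasState (uncompressedParams p W θ μ L lam2) g xinit hinit z (k + 1)).d i =
      (cedasState (uncompressedParams p W θ μ L lam2) g xinit hinit z k).d i +
        (1 / 4 : ℝ) • (cedasMessage W θ μ L lam2 g xinit hinit z k i -
          ∑ j, W i j • cedasMessage W θ μ L lam2 g xinit hinit z k j) := by
  have h := cedasState_hw W θ μ L lam2 g xinit hinit z k i
  simp only [cedasState, cedasStep, cedasMessage] at h ⊢
  rw [h]
  simp only [uncompressedParams, id, add_sub_cancel]
  rw [← Finset.sum_add_distrib]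
  congr 2
  · norm_num
  · congr 1
    exact Finset.sum_congr rfl fun j _ => by rw [← smul_add, add_sub_cancel]

lemma cedasState_x_succ (k : ℕ) (i : Fin n) :
    (cedasState (uncompressedParams p W θ μ L lam2) g xinit hinit z (k + 1)).x i =
      cedasMessage W θ μ L lam2 g xinit hinit z k i -
        (1 / 4 : ℝ) • (cedasMessage W θ μ L lam2 g xinit hinit z k i -
          ∑ j, W i j • cedasMessage W θ μ L lam2 g xinit hinit z k j) := by
  have h := cedasState_d_succ W θ μ L lam2 g xinit hinit z k i
  have h1 : (cedasState (uncompressedParams p W θ μ L lam2) g xinit hinit z (k + 1)).x i =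
      cedasMessage W θ μ L lam2 g xinit hinit z k i +
      (cedasState (uncompressedParams p W θ μ L lam2) g xinit hinit z k).d i -
      (cedasState (uncompressedParams p W θ μ L lam2) g xinit hinit z (k + 1)).d i := by
    simp only [cedasState, cedasStep, cedasMessage, uncompressedParams]
    abel
  rw [h1, h]
  abel

end Recursion

section Measurability

variable {Ω : Type*} [MeasurableSpace Ξ] {W : Matrix (Fin n) (Fin n) ℝ} {θ μ L lam2 : ℝ}
  {g : Fin n → Vec p → Ξ → Vec p} {xinit hinit : Fin n → Vec p} {ξ : Fin n → ℕ → Ω → Ξ}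

/-- The state at `k` involves samples with index at most `k` only. The σ-algebra is arbitrary, so
the lemma also applies to the one generated by all samples but one. -/
lemma measurable_cedasState {m : MeasurableSpace Ω}
    (hg : ∀ i, Measurable (fun a : Vec p × Ξ => g i a.1 a.2)) (k : ℕ)
    (hξ : ∀ i t, t ≤ k → Measurable (ξ i t)) (i : Fin n) :
    Measurable (fun ω => (cedasState (uncompressedParams p W θ μ L lam2) g xinit hinit
      (fun t j => ξ j t ω) k).x i) ∧
    Measurable (fun ω => (cedasState (uncompressedParams p W θ μ L lam2) g xinit hinit
      (fun t j => ξ j t ω) k).d i) := by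
  induction k generalizing i with
  | zero =>
    refine ⟨?_, measurable_const⟩
    have h : Measurable fun ω => g i (xinit i) (ξ i 0 ω) :=
      (hg i).comp (measurable_const.prodMk (hξ i 0 le_rfl))
    have h' : Measurable fun ω => decreasingStepsize θ μ (stepsizeOffset θ μ L lam2) (-1) •
        g i (xinit i) (ξ i 0 ω) :=
      h.const_smul (decreasingStepsize θ μ (stepsizeOffset θ μ L lam2) (-1))
    exact measurable_const.sub h'
  | succ k ih =>
    have ih' := ih fun i t ht => hξ i t (Nat.le_succ_of_le ht)
    have hy : ∀ j, Measurable fun ω => cedasMessage W θ μ L lam2 g xinit hinit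
        (fun t j => ξ j t ω) k j := fun j => by
      have h := ((hg j).comp ((ih' j).1.prodMk (hξ j (k + 1) le_rfl))).const_smul
        (decreasingStepsize θ μ (stepsizeOffset θ μ L lam2) k)
      exact ((ih' j).1.sub h).sub (ih' j).2
    have hs : Measurable fun ω => ∑ j, W i j • cedasMessage W θ μ L lam2 g xinit hinit
        (fun t j => ξ j t ω) k j :=
      Finset.measurable_sum _ fun j _ => (hy j).const_smul (W i j)
    simp only [cedasState_x_succ, cedasState_d_succ]
    exact ⟨(hy i).sub (((hy i).sub hs).const_smul (1 / 4 : ℝ)),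
      (ih' i).2.add (((hy i).sub hs).const_smul (1 / 4 : ℝ))⟩

end Measurability

end Algorithm

/-! ### Gradients of the objectives. -/

section Gradients

variable {n p : ℕ} {f : Fin n → Vec p → ℝ} {μ L : ℝ}

lemma gradient_avgObjective (hf : ∀ i, Differentiable ℝ (f i)) (x : Vec p) :
    gradient (avgObjective f) x = (1 / (n : ℝ)) • ∑ i, gradient (f i) x := by
  have h : fderiv ℝ (avgObjective f) x = (1 / (n : ℝ)) • ∑ i, fderiv ℝ (f i) x := by
    unfold avgObjective
    have hs : DifferentiableAt ℝ (fun x => ∑ i, f i x) x :=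
      DifferentiableAt.fun_sum fun i _ => hf i x
    rw [fderiv_const_mul hs, fderiv_fun_sum fun i _ => hf i x]
  simp only [gradient, h, map_smulₛₗ, map_sum]
  simp

lemma sum_gradient_eq_zero (hn : n ≠ 0) (hf : ∀ i, Differentiable ℝ (f i)) {xstar : Vec p}
    (hx : ∀ y, avgObjective f xstar ≤ avgObjective f y) : ∑ i, gradient (f i) xstar = 0 := by
  have h1 : gradient (avgObjective f) xstar = 0 := by
    have : fderiv ℝ (avgObjective f) xstar = 0 :=
      IsLocalMin.fderiv_eq_zero (Filter.Eventually.of_forall hx)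
    simp [gradient, this]
  rw [gradient_avgObjective hf] at h1
  have : (1 / (n : ℝ)) ≠ 0 := by positivity
  exact (smul_eq_zero.1 h1).resolve_left this

lemma SmoothStronglyConvex.measurable_gradient (hf : SmoothStronglyConvex f μ L) (i : Fin n) :
    Measurable (gradient (f i)) := by
  have h : LipschitzWith (Real.toNNReal L) (gradient (f i)) := by
    refine LipschitzWith.of_dist_le_mul fun x y => ?_
    rw [dist_eq_norm, dist_eq_norm]
    exact (hf.lipschitz i x y).trans
      (mul_le_mul_of_nonneg_right (Real.le_coe_toNNReal L) (norm_nonneg _))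
  exact h.continuous.measurable

lemma SmoothStronglyConvex.memLp_gradient_sub (hf : SmoothStronglyConvex f μ L) (i : Fin n)
    {Ω : Type*} [MeasurableSpace Ω] {P : Measure Ω} [IsProbabilityMeasure P] {X Y : Ω → Vec p}
    (hX : MemLp X 2 P) (hY : MemLp Y 2 P) :
    MemLp (fun ω => gradient (f i) (X ω) - gradient (f i) (Y ω)) 2 P := by
  have hm := hf.measurable_gradient i
  refine MemLp.of_le_mul (c := L) (hX.sub hY) ?_ (.of_forall fun ω => hf.lipschitz i _ _)
  exact ((hm.comp_aemeasurable hX.1.aemeasurable).sub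
    (hm.comp_aemeasurable hY.1.aemeasurable)).aestronglyMeasurable

lemma SmoothStronglyConvex.memLp_gradient (hf : SmoothStronglyConvex f μ L) (i : Fin n)
    {Ω : Type*} [MeasurableSpace Ω] {P : Measure Ω} [IsProbabilityMeasure P] {X : Ω → Vec p}
    (hX : MemLp X 2 P) : MemLp (fun ω => gradient (f i) (X ω)) 2 P := by
  have h := (hf.memLp_gradient_sub i hX (memLp_const (0 : Vec p))).add
    (memLp_const (gradient (f i) 0))
  refine (memLp_congr_ae (.of_forall fun ω => ?_)).1 h
  simp

end Gradients

/-! ### From random runs to error steps in `L²`. -/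

/-- A square integrable run of the uncompressed algorithm with primal variables `X`, dual variables
`D` and stochastic gradients `γ` whose noise is centred and uncorrelated. -/
structure StochasticRun {n p : ℕ} {Ω : Type*} [MeasurableSpace Ω] (P : Measure Ω)
    (W : Matrix (Fin n) (Fin n) ℝ) (f : Fin n → Vec p → ℝ) (η : ℕ → ℝ) (σ : ℝ)
    (X D γ : ℕ → Fin n → Ω → Vec p) : Prop where
  memLp_X : ∀ k i, MemLp (X k i) 2 P
  memLp_D : ∀ k i, MemLp (D k i) 2 P
  memLp_γ : ∀ k i, MemLp (γ k i) 2 P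
  D_zero : ∀ i ω, D 0 i ω = 0
  X_succ : ∀ k i ω, X (k + 1) i ω = (X k i ω - η k • γ k i ω - D k i ω) - (1 / 4 : ℝ) •
    ((X k i ω - η k • γ k i ω - D k i ω) - ∑ j, W i j • (X k j ω - η k • γ k j ω - D k j ω))
  D_succ : ∀ k i ω, D (k + 1) i ω = D k i ω + (1 / 4 : ℝ) •
    ((X k i ω - η k • γ k i ω - D k i ω) - ∑ j, W i j • (X k j ω - η k • γ k j ω - D k j ω))
  noise_orthogonal : ∀ k i j (φ : Vec p → Vec p), Measurable φ → MemLp (fun ω => φ (X k j ω)) 2 P →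
    ∫ ω, inner ℝ (φ (X k j ω)) (γ k i ω - gradient (f i) (X k i ω)) ∂P = 0
  noise_noise : ∀ k i j, i ≠ j → ∫ ω, inner ℝ (γ k i ω - gradient (f i) (X k i ω))
    (γ k j ω - gradient (f j) (X k j ω)) ∂P = 0
  noise_sq : ∀ k i, ∫ ω, ‖γ k i ω - gradient (f i) (X k i ω)‖ ^ 2 ∂P ≤ σ ^ 2

namespace StochasticRun

variable {n p : ℕ} {Ω : Type*} [MeasurableSpace Ω] {P : Measure Ω}
  {W : Matrix (Fin n) (Fin n) ℝ} {f : Fin n → Vec p → ℝ} {η : ℕ → ℝ} {σ μ L : ℝ}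
  {X D γ : ℕ → Fin n → Ω → Vec p}

lemma sum_D (h : StochasticRun P W f η σ X D γ) (hcol : ∀ j, ∑ i, W i j = 1) (k : ℕ) (ω : Ω) : ∑ i, D k i ω = 0 := by
  induction k with
  | zero => simp [h.D_zero]
  | succ k ih =>
    simp only [h.D_succ]
    rw [Finset.sum_add_distrib, ih, ← Finset.smul_sum, Finset.sum_sub_distrib, Finset.sum_comm]
    simp only [← Finset.sum_smul, hcol, one_smul, sub_self, smul_zero, add_zero]

variable [IsProbabilityMeasure P] (h : StochasticRun P W f η σ X D γ) (xstar : Vec p)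

/-- The primal error. -/
noncomputable def xError (k : ℕ) (i : Fin n) : squareIntegrable (Vec p) P :=
  ⟨fun ω => X k i ω - xstar, (h.memLp_X k i).sub (memLp_const _)⟩

/-- The local gradient at the minimizer, as a constant function. -/
noncomputable def gradStar (P : Measure Ω) [IsProbabilityMeasure P] (f : Fin n → Vec p → ℝ) (xstar : Vec p)
    (i : Fin n) : squareIntegrable (Vec p) P :=
  ⟨fun _ => gradient (f i) xstar, memLp_const _⟩

/-- The dual error. -/
noncomputable def sError (k : ℕ) (i : Fin n) : squareIntegrable (Vec p) P :=
  ⟨fun ω => D k i ω + η k • gradient (f i) xstar, (h.memLp_D k i).add (memLp_const _)⟩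

/-- The gradient difference. -/
noncomputable def gError (hf : SmoothStronglyConvex f μ L) (k : ℕ) (i : Fin n) : squareIntegrable (Vec p) P :=
  ⟨fun ω => gradient (f i) (X k i ω) - gradient (f i) xstar,
    hf.memLp_gradient_sub i (h.memLp_X k i) (memLp_const _)⟩

/-- The gradient noise. -/
noncomputable def noise (hf : SmoothStronglyConvex f μ L) (k : ℕ) (i : Fin n) : squareIntegrable (Vec p) P :=
  ⟨fun ω => γ k i ω - gradient (f i) (X k i ω),
    (h.memLp_γ k i).sub (hf.memLp_gradient i (h.memLp_X k i))⟩

/-- The mean error. -/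
noncomputable def meanError (k : ℕ) : squareIntegrable (Vec p) P :=
  (1 / (n : ℝ)) • ∑ j, h.xError xstar k j

/-- The gradient difference at the mean iterate. -/
noncomputable def gMean (hf : SmoothStronglyConvex f μ L) (k : ℕ) (i : Fin n) : squareIntegrable (Vec p) P :=
  ⟨fun ω => gradient (f i) ((h.meanError xstar k).1 ω + xstar) - gradient (f i) xstar,
    hf.memLp_gradient_sub i ((h.meanError xstar k).2.add (memLp_const _)) (memLp_const _)⟩

/-- The shift `η ∇f_i(x⋆)` in the dual error cancels the one in the gradient difference. -/
lemma message_sub (hf : SmoothStronglyConvex f μ L) (k : ℕ) (i : Fin n) (ω : Ω) :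
    (h.xError xstar k i - η k • (h.gError xstar hf k i + h.noise hf k i) - h.sError xstar k i).1 ω =
      (X k i ω - η k • γ k i ω - D k i ω) - xstar := by
  change (X k i ω - xstar) - η k • ((gradient (f i) (X k i ω) - gradient (f i) xstar) +
    (γ k i ω - gradient (f i) (X k i ω))) - (D k i ω + η k • gradient (f i) xstar) = _
  module

lemma mixed_message_sub (hrow : ∀ i, ∑ j, W i j = 1) (hf : SmoothStronglyConvex f μ L) (k : ℕ)
    (i : Fin n) (ω : Ω) :
    (∑ j, W i j • (h.xError xstar k j - η k • (h.gError xstar hf k j + h.noise hf k j) -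
      h.sError xstar k j)).1 ω =
      ∑ j, W i j • (X k j ω - η k • γ k j ω - D k j ω) - xstar := by
  rw [Submodule.coe_sum, Finset.sum_apply]
  have h1 : ∀ j, (W i j • (h.xError xstar k j - η k • (h.gError xstar hf k j + h.noise hf k j) -
      h.sError xstar k j)).1 ω =
      W i j • (X k j ω - η k • γ k j ω - D k j ω) - W i j • xstar := fun j => by
    rw [← smul_sub, ← h.message_sub xstar hf]; rfl
  rw [Finset.sum_congr rfl fun j _ => h1 j, Finset.sum_sub_distrib, ← Finset.sum_smul, hrow,
    one_smul]

/-- Unit row sums make `x⋆` invariant under mixing; unit column sums and `∑ ∇f_i(x⋆) = 0` keep the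
dual errors at zero sum. The fields `lipschitz` and `mean` are pointwise inequalities integrated
over `Ω`. -/
theorem errorStep (hn : n ≠ 0) (hcol : ∀ j, ∑ i, W i j = 1) (hrow : ∀ i, ∑ j, W i j = 1)
    (hf : SmoothStronglyConvex f μ L) (hx : ∀ y, avgObjective f xstar ≤ avgObjective f y) (k : ℕ) :
    ErrorStep W (η k) (η k - η (k + 1)) L μ σ (fun i => toL2 P (h.xError xstar k i))
      (fun i => toL2 P (h.sError xstar k i)) (fun i => toL2 P (h.gError xstar hf k i))
      (fun i => toL2 P (h.noise hf k i)) (fun i => toL2 P (gradStar P f xstar i))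
      (fun i => toL2 P (h.xError xstar (k + 1) i))
      (fun i => toL2 P (h.sError xstar (k + 1) i)) where
  x_eq i := by
    simp only [← map_smul, ← map_add, ← map_sub, ← map_sum]
    congr 1
    refine Subtype.ext (funext fun ω => ?_)
    have h1 := h.message_sub xstar hf k i ω
    have h2 := h.mixed_message_sub xstar hrow hf k i ω
    have h3 := h.X_succ k i ω
    change X (k + 1) i ω - xstar = _ - (1 / 4 : ℝ) • (_ - _)
    rw [h1, h2, h3]
    module
  s_eq i := by
    simp only [← map_smul, ← map_add, ← map_sub, ← map_sum]
    congr 1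
    refine Subtype.ext (funext fun ω => ?_)
    have h1 := h.message_sub xstar hf k i ω
    have h2 := h.mixed_message_sub xstar hrow hf k i ω
    have h3 := h.D_succ k i ω
    change D (k + 1) i ω + η (k + 1) • gradient (f i) xstar =
      (D k i ω + η k • gradient (f i) xstar) + (1 / 4 : ℝ) • (_ - _)
        - (η k - η (k + 1)) • gradient (f i) xstar
    rw [h1, h2, h3]
    module
  sum_s := by
    rw [← map_sum]
    have : ∑ i, h.sError xstar k i = 0 := by
      refine Subtype.ext (funext fun ω => ?_)
      rw [Submodule.coe_sum, Finset.sum_apply]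
      change ∑ i, (D k i ω + η k • gradient (f i) xstar) = 0
      rw [Finset.sum_add_distrib, h.sum_D hcol, ← Finset.smul_sum,
        sum_gradient_eq_zero hn hf.differentiable hx, smul_zero, add_zero]
    rw [this, map_zero]
  noise_x i j := by
    rw [real_inner_comm, inner_toL2]
    exact h.noise_orthogonal k i j (fun v => v - xstar) (measurable_id.sub_const _)
      (h.xError xstar k j).2
  noise_G i j := by
    rw [real_inner_comm, inner_toL2]
    exact h.noise_orthogonal k i j (fun v => gradient (f j) v - gradient (f j) xstar)
      ((hf.measurable_gradient j).sub_const _) (h.gError xstar hf k j).2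
  noise_noise i j hij := by
    rw [inner_toL2]
    exact h.noise_noise k i j hij
  noise_sq i := by
    rw [norm_sq_toL2]
    exact h.noise_sq k i
  lipschitz i := norm_toL2_le fun ω => hf.lipschitz i _ _
  mean := by
    have hmean : (1 / (n : ℝ)) • ∑ j, toL2 P (h.xError xstar k j) =
        toL2 P (h.meanError xstar k) := by
      rw [meanError, map_smul, map_sum]
    rw [hmean]
    refine ⟨fun i => toL2 P (h.gMean xstar hf k i), fun i => ?_, ?_⟩
    · rw [← map_sub, ← map_sub]
      refine norm_toL2_le fun ω => ?_
      have h1 := hf.lipschitz i (X k i ω) ((h.meanError xstar k).1 ω + xstar)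
      have e1 : X k i ω - ((h.meanError xstar k).1 ω + xstar) =
        (X k i ω - xstar) - (h.meanError xstar k).1 ω := by abel
      rw [e1] at h1
      change ‖(gradient (f i) (X k i ω) - gradient (f i) xstar) -
        (gradient (f i) ((h.meanError xstar k).1 ω + xstar) - gradient (f i) xstar)‖ ≤ _
      rw [sub_sub_sub_cancel_right]
      exact h1
    · rw [← map_sum, norm_sq_toL2, inner_toL2, ← integral_const_mul]
      refine integral_mono ?_ ?_ fun ω => ?_
      · exact ((memLp_two_iff_integrable_sq_norm (h.meanError xstar k).2.1).1
          (h.meanError xstar k).2).const_mul _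
      · exact integrable_inner_of_memLp (∑ i, h.gMean xstar hf k i).2 (h.meanError xstar k).2
      · have h1 := hf.strongly_convex ((h.meanError xstar k).1 ω + xstar) xstar
        rw [gradient_avgObjective hf.differentiable, gradient_avgObjective hf.differentiable,
          ← smul_sub, ← Finset.sum_sub_distrib, add_sub_cancel_right, real_inner_smul_left] at h1
        have hn' : (n : ℝ) ≠ 0 := by exact_mod_cast hn
        have h2 := mul_le_mul_of_nonneg_left h1 (Nat.cast_nonneg n : (0 : ℝ) ≤ n)
        rw [← mul_assoc, ← mul_assoc, mul_one_div_cancel hn', one_mul] at h2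
        refine h2.trans_eq ?_
        rw [Submodule.coe_sum, Finset.sum_apply]
        rfl

end StochasticRun

/-! ### Stochastic gradients along the CEDAS iterates. -/

lemma measurable_noise {p : ℕ} {Ξ Ω : Type*} [MeasurableSpace Ξ] {_ : MeasurableSpace Ω}
    {γ : Vec p → Ξ → Vec p} {φ : Vec p → Vec p} {X : Ω → Vec p} {ζ : Ω → Ξ}
    (hγ : Measurable (fun a : Vec p × Ξ => γ a.1 a.2)) (hφ : Measurable φ) (hX : Measurable X)
    (hζ : Measurable ζ) : Measurable fun ω => γ (X ω) (ζ ω) - φ (X ω) :=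
  (hγ.comp (hX.prodMk hζ)).sub (hφ.comp hX)

namespace StochasticGradients

variable {n p : ℕ} {Ξ Ω : Type*} [MeasurableSpace Ξ] [MeasurableSpace Ω] {P : Measure Ω}
  {f : Fin n → Vec p → ℝ} {g : Fin n → Vec p → Ξ → Vec p}
  {ξ : Fin n → ℕ → Ω → Ξ} {X : Fin n → ℕ → Ω → Vec p} {σ μ L : ℝ}

lemma memLp_noise (h : StochasticGradients P f g ξ X σ) (hf : SmoothStronglyConvex f μ L)
    {i : Fin n} {t : ℕ} (hX : Measurable (X i t)) :
    MemLp (fun ω => g i (X i t ω) (ξ i t ω) - gradient (f i) (X i t ω)) 2 P := by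
  have hm := measurable_noise (h.measurable_grad i) (hf.measurable_gradient i) hX
    (h.measurable_sample i t)
  exact (memLp_two_iff_integrable_sq_norm hm.aestronglyMeasurable).2 (h.integrable_sq i t)

variable [IsProbabilityMeasure P]

lemma memLp_grad (h : StochasticGradients P f g ξ X σ) (hf : SmoothStronglyConvex f μ L)
    {i : Fin n} {t : ℕ} (hX : Measurable (X i t)) (hX2 : MemLp (X i t) 2 P) :
    MemLp (fun ω => g i (X i t ω) (ξ i t ω)) 2 P := by
  refine (memLp_congr_ae (.of_forall fun ω => ?_)).1
    ((h.memLp_noise hf hX).add (hf.memLp_gradient i hX2))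
  simp

lemma integral_noise_sq_le (h : StochasticGradients P f g ξ X σ) {i : Fin n} {t : ℕ}
    (hX : Measurable (X i t)) :
    ∫ ω, ‖g i (X i t ω) (ξ i t ω) - gradient (f i) (X i t ω)‖ ^ 2 ∂P ≤ σ ^ 2 := by
  rw [← integral_condExp hX.comap_le]
  calc _ ≤ ∫ _, σ ^ 2 ∂P := integral_mono_ae integrable_condExp (integrable_const _)
        (h.variance_le i t)
    _ = σ ^ 2 := by simp

lemma integral_inner_noise (h : StochasticGradients P f g ξ X σ) (hf : SmoothStronglyConvex f μ L)
    {i : Fin n} {t : ℕ} {Z : Ω → Vec p} (hX : Measurable (X i t)) (hX2 : MemLp (X i t) 2 P)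
    (hZ : Measurable Z) (hZ2 : MemLp Z 2 P)
    (hX' : Measurable[⨆ b ∈ ({(i, t)}ᶜ : Set (Fin n × ℕ)),
      MeasurableSpace.comap (ξ b.1 b.2) inferInstance] (X i t))
    (hZ' : Measurable[⨆ b ∈ ({(i, t)}ᶜ : Set (Fin n × ℕ)),
      MeasurableSpace.comap (ξ b.1 b.2) inferInstance] Z) :
    ∫ ω, inner ℝ (Z ω) (g i (X i t ω) (ξ i t ω) - gradient (f i) (X i t ω)) ∂P = 0 := by
  have hind : IndepFun (fun ω => (X i t ω, Z ω)) (ξ i t) P :=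
    indepFun_of_measurable_compl (ξ := fun a : Fin n × ℕ => ξ a.1 a.2)
      (fun a => h.measurable_sample a.1 a.2) h.indep (i, t) (hX'.prodMk hZ')
  have he : Measurable fun a : Vec p × Ξ => g i a.1 a.2 - gradient (f i) a.1 :=
    (h.measurable_grad i).sub ((hf.measurable_gradient i).comp measurable_fst)
  have hc : P[fun ω => g i (X i t ω) (ξ i t ω) - gradient (f i) (X i t ω) |
      MeasurableSpace.comap (X i t) inferInstance] =ᵐ[P] 0 :=
    condExp_noise_eq_zero (φ := gradient (f i)) hX (hf.measurable_gradient i) rfl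
      ((h.memLp_grad hf hX hX2).integrable (by norm_num))
      ((hf.memLp_gradient i hX2).integrable (by norm_num)) (h.unbiased i t)
  exact integral_inner_noise_eq_zero hX hZ (h.measurable_sample i t) hind he
    (h.memLp_noise hf hX) hZ2 hc

end StochasticGradients

section Cedas

variable {n p : ℕ} {Ξ Ω : Type*} [MeasurableSpace Ξ] [MeasurableSpace Ω] {P : Measure Ω}
  [IsProbabilityMeasure P] {f : Fin n → Vec p → ℝ} {g : Fin n → Vec p → Ξ → Vec p}
  {ξ : Fin n → ℕ → Ω → Ξ} {σ μ L θ lam2 : ℝ} {W : Matrix (Fin n) (Fin n) ℝ}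
  {xinit hinit : Fin n → Vec p}

lemma memLp_cedasState (hf : SmoothStronglyConvex f μ L)
    (h : StochasticGradients P f g ξ
      (cedasQuery (uncompressedParams p W θ μ L lam2) g xinit hinit ξ) σ) (k : ℕ) (i : Fin n) :
    MemLp (cedasIterate (uncompressedParams p W θ μ L lam2) g xinit hinit ξ i k) 2 P ∧
    MemLp (fun ω => (cedasState (uncompressedParams p W θ μ L lam2) g xinit hinit
      (fun t j => ξ j t ω) k).d i) 2 P := by
  induction k generalizing i with
  | zero =>
    refine ⟨?_, memLp_const 0⟩
    have hg := h.memLp_grad hf (i := i) (t := 0) measurable_const (memLp_const _)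
    exact (memLp_const (xinit i)).sub
      (hg.const_smul (decreasingStepsize θ μ (stepsizeOffset θ μ L lam2) (-1)))
  | succ k ih =>
    have hX : ∀ j, Measurable (cedasQuery (uncompressedParams p W θ μ L lam2) g xinit hinit ξ j
        (k + 1)) := fun j =>
      (measurable_cedasState h.measurable_grad k (fun i t _ => h.measurable_sample i t) j).1
    have hy : ∀ j, MemLp (fun ω => cedasMessage W θ μ L lam2 g xinit hinit
        (fun t j => ξ j t ω) k j) 2 P := fun j =>
      ((ih j).1.sub ((h.memLp_grad hf (hX j) (ih j).1).const_smul
        (decreasingStepsize θ μ (stepsizeOffset θ μ L lam2) k))).sub (ih j).2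
    have hs : MemLp (fun ω => ∑ j, W i j • cedasMessage W θ μ L lam2 g xinit hinit
        (fun t j => ξ j t ω) k j) 2 P :=
      memLp_finsetSum _ fun j _ => (hy j).const_smul (W i j)
    have hd := ((hy i).sub hs).const_smul (1 / 4 : ℝ)
    constructor
    · unfold cedasIterate
      simp only [cedasState_x_succ]
      exact (hy i).sub hd
    · simp only [cedasState_d_succ]
      exact (ih i).2.add hd

theorem cedas_stochasticRun (hf : SmoothStronglyConvex f μ L)
    (h : StochasticGradients P f g ξ
      (cedasQuery (uncompressedParams p W θ μ L lam2) g xinit hinit ξ) σ) :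
    StochasticRun P W f
      (fun k => decreasingStepsize θ μ (stepsizeOffset θ μ L lam2) k) σ
      (fun k i => cedasIterate (uncompressedParams p W θ μ L lam2) g xinit hinit ξ i k)
      (fun k i ω => (cedasState (uncompressedParams p W θ μ L lam2) g xinit hinit
        (fun t j => ξ j t ω) k).d i)
      (fun k i ω => g i (cedasIterate (uncompressedParams p W θ μ L lam2) g xinit hinit ξ i k ω)
        (ξ i (k + 1) ω)) := by
  have hX : ∀ k j, Measurable (cedasQuery (uncompressedParams p W θ μ L lam2) g xinit hinit ξ j
      (k + 1)) := fun k j =>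
    (measurable_cedasState h.measurable_grad k (fun i t _ => h.measurable_sample i t) j).1
  have hX2 : ∀ k j, MemLp (cedasQuery (uncompressedParams p W θ μ L lam2) g xinit hinit ξ j
      (k + 1)) 2 P := fun k j => (memLp_cedasState hf h k j).1
  -- Query `k + 1` is the iterate `k`, which uses samples of index at most `k`; hence it avoids the
  -- sample `(i, k + 1)` of every agent `i`.
  have hX' : ∀ k i j, Measurable[⨆ b ∈ ({(i, k + 1)}ᶜ : Set (Fin n × ℕ)),
      MeasurableSpace.comap (ξ b.1 b.2) inferInstance]
      (cedasQuery (uncompressedParams p W θ μ L lam2) g xinit hinit ξ j (k + 1)) := fun k i j =>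
    (measurable_cedasState h.measurable_grad k (fun l t ht =>
      measurable_of_mem_compl (fun b : Fin n × ℕ => ξ b.1 b.2) (a := (i, k + 1)) (b := (l, t))
        (fun e => by have := congrArg Prod.snd e; simp only at this; omega)) j).1
  refine
    { memLp_X := fun k i => (memLp_cedasState hf h k i).1
      memLp_D := fun k i => (memLp_cedasState hf h k i).2
      memLp_γ := fun k i => h.memLp_grad (t := k + 1) hf (hX k i) (hX2 k i)
      D_zero := fun i ω => rfl
      X_succ := fun k i ω => ?_
      D_succ := fun k i ω => ?_
      noise_orthogonal := fun k i j φ hφ hφ2 => ?_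
      noise_noise := fun k i j hij => ?_
      noise_sq := fun k i => h.integral_noise_sq_le (t := k + 1) (hX k i) }
  · have h1 := cedasState_x_succ W θ μ L lam2 g xinit hinit (fun t j => ξ j t ω) k i
    simp only [cedasMessage] at h1
    unfold cedasIterate
    exact h1
  · have h1 := cedasState_d_succ W θ μ L lam2 g xinit hinit (fun t j => ξ j t ω) k i
    simp only [cedasMessage] at h1
    unfold cedasIterate
    exact h1
  · exact h.integral_inner_noise (t := k + 1) hf (hX k i) (hX2 k i) (hφ.comp (hX k j)) hφ2 (hX' k i i)
      (hφ.comp (hX' k i j))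
  -- The noise of agent `i` plays the role of `Z`: it uses the sample `(i, k + 1)`, which differs
  -- from the integrated sample `(j, k + 1)`.
  · exact h.integral_inner_noise (t := k + 1) hf (hX k j) (hX2 k j)
      (measurable_noise (h.measurable_grad i) (hf.measurable_gradient i) (hX k i)
        (h.measurable_sample i _))
      (h.memLp_noise hf (hX k i)) (hX' k j j)
      (measurable_noise (h.measurable_grad i) (hf.measurable_gradient i) (hX' k j i)
        (measurable_of_mem_compl (fun b : Fin n × ℕ => ξ b.1 b.2)
          (a := (j, k + 1)) (b := (i, k + 1)) (fun e => hij (congrArg Prod.fst e))))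

lemma norm_add_four_sq_le {E : Type*} [SeminormedAddCommGroup E] (a b c d : E) :
    ‖a + b + c + d‖ ^ 2 ≤ 4 * (‖a‖ ^ 2 + ‖b‖ ^ 2 + ‖c‖ ^ 2 + ‖d‖ ^ 2) := by
  have h1 := norm_add₄_le (a := a) (b := b) (c := c) (d := d)
  have h2 := pow_le_pow_left₀ (norm_nonneg _) h1 2
  nlinarith [sq_nonneg (‖a‖ - ‖b‖), sq_nonneg (‖a‖ - ‖c‖), sq_nonneg (‖a‖ - ‖d‖),
    sq_nonneg (‖b‖ - ‖c‖), sq_nonneg (‖b‖ - ‖d‖), sq_nonneg (‖c‖ - ‖d‖)]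

lemma integral_initial_error_le (hf : SmoothStronglyConvex f μ L)
    (h : StochasticGradients P f g ξ
      (cedasQuery (uncompressedParams p W θ μ L lam2) g xinit hinit ξ) σ) (xstar : Vec p) {η : ℝ}
    (hη : η = decreasingStepsize θ μ (stepsizeOffset θ μ L lam2) (-1)) (i : Fin n) :
    ∫ ω, ‖cedasIterate (uncompressedParams p W θ μ L lam2) g xinit hinit ξ i 0 ω - xstar‖ ^ 2 ∂P ≤
      4 * (1 + η ^ 2 * L ^ 2) * ‖xinit i - xstar‖ ^ 2 +
        4 * η ^ 2 * ‖gradient (f i) xstar‖ ^ 2 + 4 * η ^ 2 * σ ^ 2 := by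
  have hnoise : MemLp (fun ω => g i (xinit i) (ξ i 0 ω) - gradient (f i) (xinit i)) 2 P :=
    h.memLp_noise hf (i := i) (t := 0) measurable_const
  have hvar : ∫ ω, ‖g i (xinit i) (ξ i 0 ω) - gradient (f i) (xinit i)‖ ^ 2 ∂P ≤ σ ^ 2 :=
    h.integral_noise_sq_le (i := i) (t := 0) measurable_const
  have hint := (memLp_two_iff_integrable_sq_norm hnoise.1).1 hnoise
  set e : Ω → Vec p := fun ω => g i (xinit i) (ξ i 0 ω) - gradient (f i) (xinit i) with he
  set a := xinit i - xstar with ha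
  set G := gradient (f i) (xinit i) - gradient (f i) xstar with hG
  have hGL : ‖G‖ ^ 2 ≤ L ^ 2 * ‖a‖ ^ 2 := by
    rw [← mul_pow]; exact pow_le_pow_left₀ (norm_nonneg _) (hf.lipschitz i _ _) 2
  have hpt : ∀ ω, ‖cedasIterate (uncompressedParams p W θ μ L lam2) g xinit hinit ξ i 0 ω
      - xstar‖ ^ 2 ≤ 4 * (1 + η ^ 2 * L ^ 2) * ‖a‖ ^ 2 +
        4 * η ^ 2 * ‖gradient (f i) xstar‖ ^ 2 + 4 * η ^ 2 * ‖e ω‖ ^ 2 := fun ω => by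
    -- Initial error, gradient difference, gradient at `x⋆` and noise are separated, since each is
    -- bounded by a different datum.
    have e1 : cedasIterate (uncompressedParams p W θ μ L lam2) g xinit hinit ξ i 0 ω - xstar =
        a + (-η) • G + (-η) • gradient (f i) xstar + (-η) • e ω := by
      change xinit i - decreasingStepsize θ μ (stepsizeOffset θ μ L lam2) (-1) •
        g i (xinit i) (ξ i 0 ω) - xstar = _
      rw [← hη, ha, hG, he]
      module
    rw [e1]
    refine (norm_add_four_sq_le _ _ _ _).trans ?_
    simp only [norm_smul, mul_pow, Real.norm_eq_abs, sq_abs, neg_sq]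
    have := mul_le_mul_of_nonneg_left hGL (sq_nonneg η)
    linarith
  have hX := (((memLp_cedasState hf h 0 i).1).sub (memLp_const xstar))
  calc _ ≤ ∫ ω, (4 * (1 + η ^ 2 * L ^ 2) * ‖a‖ ^ 2 +
        4 * η ^ 2 * ‖gradient (f i) xstar‖ ^ 2 + 4 * η ^ 2 * ‖e ω‖ ^ 2) ∂P :=
        integral_mono ((memLp_two_iff_integrable_sq_norm hX.1).1 hX)
          ((integrable_const _).add (hint.const_mul _)) hpt
    _ = 4 * (1 + η ^ 2 * L ^ 2) * ‖a‖ ^ 2 +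
        4 * η ^ 2 * ‖gradient (f i) xstar‖ ^ 2 + 4 * η ^ 2 * ∫ ω, ‖e ω‖ ^ 2 ∂P := by
        rw [integral_add (integrable_const _) (hint.const_mul _), integral_const_mul]
        simp [he]
    _ ≤ _ := by
        have := mul_le_mul_of_nonneg_left hvar (by positivity : 0 ≤ 4 * η ^ 2)
        linarith

end Cedas

/-! ### Assembly of the estimates. -/

/-- The one-step energy estimates in the normalized form of `EnergyRecursion`. -/
lemma energyRecursion_of_errorStep {n : ℕ} {H : Type*} [NormedAddCommGroup H]
    [InnerProductSpace ℝ H] {W : Matrix (Fin n) (Fin n) ℝ} {δ θ μ L σ m D : ℝ} {η : ℕ → ℝ}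
    (S : GapBasis W δ) (hW : ∀ i j, W i j = W j i) (hδ : 0 < δ) (hδ' : δ ≤ 1 / 2) (hθ : 0 < θ)
    (hμ : 0 < μ) (hm : 0 < m) (hη : ∀ k : ℕ, η k = θ / (μ * (k + m)))
    {x s G ε : ℕ → Fin n → H} {F : Fin n → H}
    (h : ∀ k, ErrorStep W (η k) (η k - η (k + 1)) L μ σ (x k) (s k) (G k) (ε k) F
      (x (k + 1)) (s (k + 1)))
    (hD : D = 5 * θ ^ 2 / μ ^ 2 * ∑ i, ‖F i‖ ^ 2) :
    EnergyRecursion θ (L ^ 2 * θ ^ 2 / μ ^ 2) (σ ^ 2 * θ ^ 2 / μ ^ 2) n δ m D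
      (fun k => S.meanEnergy (x k)) (fun k => S.gapEnergy (x k) (s k)) where
  P_nonneg k := S.meanEnergy_nonneg _
  Q_nonneg k := S.gapEnergy_nonneg _ _
  P_step k := by
    have ht : 0 < (k : ℝ) + m := by positivity
    have hηk := hη k
    have h1 := (h k).meanEnergy_le S hW hμ (by rw [hηk]; positivity)
    refine h1.trans_eq ?_
    rw [hηk]
    field_simp
  Q_step k := by
    have ht : 0 < (k : ℝ) + m := by positivity
    have h1 := (h k).gapEnergy_le S hW hδ hδ'
    refine h1.trans ?_
    have hΔ : (η k - η (k + 1)) ^ 2 ≤ θ ^ 2 / (μ ^ 2 * ((k : ℝ) + m) ^ 4) := by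
      -- The stepsize telescopes to order `1/t²`, so the squared drift is of order `1/t⁴`.
      have e : η k - η (k + 1) = θ / (μ * ((k + m) * (k + m + 1))) := by
        rw [hη, hη]; push_cast
        have : (k : ℝ) + 1 + m ≠ 0 := by positivity
        have : (k : ℝ) + m + 1 ≠ 0 := by positivity
        field_simp
        ring
      have e2 : θ ^ 2 / (μ ^ 2 * ((k : ℝ) + m) ^ 4) = (θ / (μ * ((k + m) * (k + m)))) ^ 2 := by
        field_simp
      have hq : ((k : ℝ) + m) * (k + m) ≤ (k + m) * (k + m + 1) :=
        mul_le_mul_of_nonneg_left (by linarith) ht.le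
      rw [e, e2]
      exact pow_le_pow_left₀ (by positivity) (div_le_div_of_nonneg_left hθ.le (by positivity)
        (mul_le_mul_of_nonneg_left hq hμ.le)) 2
    have hF : 0 ≤ ∑ i, ‖F i‖ ^ 2 := by positivity
    have h2 : 5 / δ ^ 2 * (η k - η (k + 1)) ^ 2 * ∑ i, ‖F i‖ ^ 2 ≤
        D / (δ ^ 2 * ((k : ℝ) + m) ^ 4) := by
      calc _ ≤ 5 / δ ^ 2 * (θ ^ 2 / (μ ^ 2 * ((k : ℝ) + m) ^ 4)) * ∑ i, ‖F i‖ ^ 2 := by gcongr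
        _ = _ := by rw [hD]; field_simp
    have e3 : 5 / δ * η k ^ 2 * (L ^ 2 * (S.meanEnergy (x k) + S.gapEnergy (x k) (s k))) =
        5 * (L ^ 2 * θ ^ 2 / μ ^ 2) / (δ * ((k : ℝ) + m) ^ 2) *
          (S.meanEnergy (x k) + S.gapEnergy (x k) (s k)) := by
      rw [hη]; field_simp
    have e4 : η k ^ 2 * (n * σ ^ 2) = n * (σ ^ 2 * θ ^ 2 / μ ^ 2) / ((k : ℝ) + m) ^ 2 := by
      rw [hη]; field_simp
    rw [e3, e4]
    linarith

lemma stepsizeOffset_le {θ μ L δ lam2 : ℝ} (hθ : 0 < θ) (hμ : 0 < μ) (hL : 0 < L) (hδ : 0 < δ)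
    (hδ' : δ ≤ 1 / 2) (hlam : 1 - lam2 = 4 * δ) :
    stepsizeOffset θ μ L lam2 ≤
      (16 * θ + 4 * √2 * L / μ + 3 * θ * L * √6 / (2 * μ)) / δ := by
  have h1 : 64 * θ / (1 - lam2) = 16 * θ / δ := by rw [hlam]; field_simp; norm_num
  have h2 : 16 * √2 * L / (μ * (1 - lam2)) = 4 * √2 * L / μ / δ := by
    rw [hlam]; field_simp; norm_num
  have h3 : 3 * θ * L * √6 / (2 * μ) ≤ 3 * θ * L * √6 / (2 * μ) / δ := by
    rw [le_div_iff₀ hδ]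
    exact mul_le_of_le_one_right (by positivity) (by linarith)
  have p1 : 0 < 16 * θ / δ := by positivity
  have p2 : 0 ≤ 4 * √2 * L / μ / δ := by positivity
  have p3 : 0 ≤ 3 * θ * L * √6 / (2 * μ) / δ := by positivity
  unfold stepsizeOffset
  rw [h1, h2, add_div, add_div]
  exact max_le (by linarith) (max_le (by linarith) (by linarith))

lemma le_stepsizeOffset {θ μ L δ lam2 : ℝ} (hδ : 0 < δ) (hlam : 1 - lam2 = 4 * δ) :
    16 * θ / δ ≤ stepsizeOffset θ μ L lam2 := by
  have h1 : 64 * θ / (1 - lam2) = 16 * θ / δ := by rw [hlam]; field_simp; ring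
  rw [← h1]
  exact le_max_left _ _

lemma meanSquareError_eq {n p : ℕ} {Ω : Type*} [MeasurableSpace Ω] {P : Measure Ω}
    [IsProbabilityMeasure P] {W : Matrix (Fin n) (Fin n) ℝ} {f : Fin n → Vec p → ℝ} {η : ℕ → ℝ}
    {σ : ℝ} {x : Fin n → ℕ → Ω → Vec p} {D γ : ℕ → Fin n → Ω → Vec p}
    (h : StochasticRun P W f η σ (fun k i => x i k) D γ) (xstar : Vec p) (k : ℕ) :
    meanSquareError P x xstar k = (1 / (n : ℝ)) * ∑ i, ‖toL2 P (h.xError xstar k i)‖ ^ 2 := by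
  unfold meanSquareError
  congr 1
  exact Finset.sum_congr rfl fun i _ => (norm_sq_toL2 (h.xError xstar k i)).symm

/-- Bound on the initial energy in terms of the data of the problem. -/
lemma initial_energy_arith {n c₁ c₂ μ L σ δ η η₀ F X Y Z : ℝ} (hn : 1 ≤ n) (hδ : 0 < δ)
    (hδ' : δ ≤ 1 / 2) (hμ : 0 < μ) (hη0 : 0 ≤ η) (hη : η ≤ 1 / μ) (hη₀0 : 0 ≤ η₀)
    (hη₀ : η₀ ≤ δ / μ) (hF0 : 0 ≤ F) (hX0 : 0 ≤ X) (hF : F ≤ c₁ * n ^ 3) (hX : X ≤ c₂ * n ^ 2)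
    (hY : Y ≤ 4 * (1 + η ^ 2 * L ^ 2) * X + 4 * η ^ 2 * F + 4 * η ^ 2 * (n * σ ^ 2))
    (hZ : Z = η₀ ^ 2 * F) :
    Y + 1 / δ * Z ≤
      (4 * (1 + L ^ 2 / μ ^ 2) * c₂ + 4 * (c₁ + σ ^ 2) / μ ^ 2 + c₁ / μ ^ 2) * n ^ 3 := by
  have hη2 : η ^ 2 ≤ 1 / μ ^ 2 := by
    have := pow_le_pow_left₀ hη0 hη 2
    rwa [div_pow, one_pow] at this
  have hη₀2 : η₀ ^ 2 ≤ δ ^ 2 / μ ^ 2 := by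
    have := pow_le_pow_left₀ hη₀0 hη₀ 2
    rwa [div_pow] at this
  have hn2 : n ^ 2 ≤ n ^ 3 := pow_le_pow_right₀ hn (by norm_num)
  have hn1 : n ≤ n ^ 3 := le_self_pow₀ hn (by norm_num)
  have hn0 : 0 < n := by linarith
  have hc₂ : 0 ≤ c₂ := by
    by_contra! hc
    have := mul_neg_of_neg_of_pos hc (pow_pos hn0 2)
    linarith
  have a1 : 4 * (1 + η ^ 2 * L ^ 2) * X ≤ 4 * (1 + 1 / μ ^ 2 * L ^ 2) * (c₂ * n ^ 3) := by
    have : X ≤ c₂ * n ^ 3 := hX.trans (by gcongr)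
    gcongr
  have a2 : 4 * η ^ 2 * F ≤ 4 * (1 / μ ^ 2) * (c₁ * n ^ 3) := by gcongr
  have a3 : 4 * η ^ 2 * (n * σ ^ 2) ≤ 4 * (1 / μ ^ 2) * (n ^ 3 * σ ^ 2) := by gcongr
  have a4 : 1 / δ * Z ≤ 1 / μ ^ 2 * (c₁ * n ^ 3) := by
    have : 1 / δ * η₀ ^ 2 ≤ 1 / μ ^ 2 := by
      calc 1 / δ * η₀ ^ 2 ≤ 1 / δ * (δ ^ 2 / μ ^ 2) := by gcongr
        _ = δ * (1 / μ ^ 2) := by field_simp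
        _ ≤ 1 / μ ^ 2 := mul_le_of_le_one_left (by positivity) (by linarith)
    rw [hZ, ← mul_assoc]
    gcongr
  have e : (4 * (1 + L ^ 2 / μ ^ 2) * c₂ + 4 * (c₁ + σ ^ 2) / μ ^ 2 + c₁ / μ ^ 2) * n ^ 3 =
      4 * (1 + 1 / μ ^ 2 * L ^ 2) * (c₂ * n ^ 3) + 4 * (1 / μ ^ 2) * (c₁ * n ^ 3) +
      4 * (1 / μ ^ 2) * (n ^ 3 * σ ^ 2) + 1 / μ ^ 2 * (c₁ * n ^ 3) := by ring
  rw [e]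
  linarith

lemma transientTime_le_ofReal {n : ℕ} {err : ℕ → ℝ} {A T B : ℝ} (hT : 1 ≤ T) (hB : 0 ≤ B)
    (h : ∀ k : ℕ, B * T ≤ k → 1 ≤ k → err k ≤ A / ((n : ℝ) * k)) :
    ((transientTime n err A : ℕ∞) : ℝ≥0∞) ≤ ENNReal.ofReal ((B + 1) * T) := by
  have h1 : transientTime n err A ≤ ((⌈B * T⌉₊ : ℕ) : ℕ∞) :=
    iInf₂_le _ fun k hk hk1 => h k (Nat.ceil_le.1 hk) hk1
  calc ((transientTime n err A : ℕ∞) : ℝ≥0∞) ≤ (((⌈B * T⌉₊ : ℕ) : ℕ∞) : ℝ≥0∞) :=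
        ENat.toENNReal_le.2 h1
    _ = ENNReal.ofReal (⌈B * T⌉₊ : ℝ) := by
        rw [ENNReal.ofReal_natCast, ENat.toENNReal_coe]
    _ ≤ _ := by
        refine ENNReal.ofReal_le_ofReal ?_
        have := (Nat.ceil_lt_add_one (by positivity : 0 ≤ B * T)).le
        linarith

theorem mainTheorem10
    (μ L σ θ : ℝ) (hμ : 0 < μ) (hL : 0 < L) (hσ : 0 < σ) (hθ : 18 < θ) :
    ∃ A : ℝ, 0 < A ∧
      ∀ c₁ c₂ c₃ q : ℝ, 0 < c₁ → 0 < c₂ → 0 < c₃ → 0 < q → q ≤ 4 * θ / 3 - 1 →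
        ∃ B : ℝ, 0 < B ∧
          ∀ (n p d : ℕ) (hn : 2 ≤ n)
            (G : SimpleGraph (Fin n)) (W : Matrix (Fin n) (Fin n) ℝ) (hW : IsMixingMatrix G W)
            (f : Fin n → Vec p → ℝ) (_ : SmoothStronglyConvex f μ L)
            (xstar : Vec p) (_ : ∀ y, avgObjective f xstar ≤ avgObjective f y)
            (xinit hinit : Fin n → Vec p)
            (Ω : Type*) (_ : MeasurableSpace Ω) (P : Measure Ω) (_ : IsProbabilityMeasure P)
            (g : Fin n → Vec p → Vec d → Vec p) (ξ : Fin n → ℕ → Ω → Vec d),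
            let lam2 : ℝ := secondEigenvalue hn hW.symm
            let c : CedasParams n p := uncompressedParams p W θ μ L lam2
            let x : Fin n → ℕ → Ω → Vec p := cedasIterate c g xinit hinit ξ
            StochasticGradients P f g ξ (cedasQuery c g xinit hinit ξ) σ →
            ∑ i, ‖gradient (f i) xstar‖ ^ 2 ≤ c₁ * (n : ℝ) ^ 3 →
            ∑ i, ‖xinit i - xstar‖ ^ 2 ≤ c₂ * (n : ℝ) ^ 2 →
            1 / (1 - lam2) ≤ c₃ * (n : ℝ) ^ q →
            (∀ i k, Integrable (fun ω => ‖x i k ω - xstar‖ ^ 2) P) ∧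
            ((transientTime n (meanSquareError P x xstar) A : ℕ∞) : ℝ≥0∞) ≤
              ENNReal.ofReal (B * ((n : ℝ) / (1 - lam2))) := by
  obtain ⟨A, hA, hrate⟩ := exists_rate_of_energyRecursion θ (L ^ 2 * θ ^ 2 / μ ^ 2)
    (σ ^ 2 * θ ^ 2 / μ ^ 2) (16 * θ + 4 * √2 * L / μ + 3 * θ * L * √6 / (2 * μ)) hθ
    (by positivity) (by positivity) (by positivity)
  refine ⟨A, hA, fun c₁ c₂ c₃ q hc₁ hc₂ hc₃ _ hq => ?_⟩
  -- `C` is the sum of the constants bounding `D` and the initial energy, so it bounds both; `4 *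
  -- c₃` appears because `1/δ = 4/(1 - λ₂)`.
  obtain ⟨B, hB, hbound⟩ := hrate (5 * θ ^ 2 / μ ^ 2 * c₁ +
    (4 * (1 + L ^ 2 / μ ^ 2) * c₂ + 4 * (c₁ + σ ^ 2) / μ ^ 2 + c₁ / μ ^ 2)) (4 * c₃) q
    (by positivity) (by positivity) hq
  -- `B n/δ` equals `4 B n/(1 - λ₂)`; the `1` pays for rounding up to an integer, as `n/(1 - λ₂) ≥
  -- 1`.
  refine ⟨4 * B + 1, by linarith, ?_⟩
  intro n p d hn G W hW f hf xstar hxstar xinit hinit Ω _ P _ g ξ lam2 c x hst hF hX hgap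
  obtain ⟨hlam1, hlam2, ⟨S⟩⟩ := hW.exists_gapBasis hn
  change -1 ≤ lam2 at hlam1
  change lam2 < 1 at hlam2
  obtain ⟨δ, hδdef⟩ : ∃ δ, δ = (1 - lam2) / 4 := ⟨_, rfl⟩
  have S : GapBasis W δ := by rw [hδdef]; exact S
  have hδ : 0 < δ := by linarith
  have hδ' : δ ≤ 1 / 2 := by linarith
  have hlam : 1 - lam2 = 4 * δ := by linarith
  have hrun : StochasticRun P W f (fun k => decreasingStepsize θ μ (stepsizeOffset θ μ L lam2) k) σ
      (fun k i => x i k)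
      (fun k i ω => (cedasState c g xinit hinit (fun t j => ξ j t ω) k).d i)
      (fun k i ω => g i (x i k ω) (ξ i (k + 1) ω)) := cedas_stochasticRun hf hst
  refine ⟨fun i k => ?_, ?_⟩
  · have h1 := (hrun.xError xstar k i).2
    exact (memLp_two_iff_integrable_sq_norm h1.1).1 h1
  have hinit0 := integral_initial_error_le hf hst xstar rfl
  obtain ⟨m, hm⟩ : ∃ m, m = stepsizeOffset θ μ L lam2 := ⟨_, rfl⟩
  have hm1 : 16 * θ / δ ≤ m := by rw [hm]; exact le_stepsizeOffset hδ hlam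
  have hm2 := stepsizeOffset_le (θ := θ) (by linarith) hμ hL hδ hδ' hlam
  rw [← hm] at hm2
  have hδθ : 32 * θ ≤ 16 * θ / δ := by
    rw [le_div_iff₀ hδ]
    have := mul_le_mul_of_nonneg_left hδ' (by linarith : 0 ≤ 32 * θ)
    linarith
  have hm0 : 0 < m := by linarith
  have hn1 : (1 : ℝ) ≤ n := by exact_mod_cast (by omega : 1 ≤ n)
  have hn2 : (2 : ℝ) ≤ n := by exact_mod_cast hn
  have hF' : ∑ i, ‖toL2 P (StochasticRun.gradStar P f xstar i)‖ ^ 2 =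
      ∑ i, ‖gradient (f i) xstar‖ ^ 2 := Finset.sum_congr rfl fun i _ => by
    rw [norm_sq_toL2]; simp [StochasticRun.gradStar]
  have hrec := energyRecursion_of_errorStep S hW.apply_comm hδ hδ' (by linarith : 0 < θ) hμ hm0
    (fun k => by rw [← hm]; simp [decreasingStepsize])
    (fun k => hrun.errorStep xstar (by omega) hW.sum_col hW.stochastic hf hxstar k) rfl
  rw [hF'] at hrec
  have hE0 : S.meanEnergy (fun i => toL2 P (hrun.xError xstar 0 i)) +
      S.gapEnergy (fun i => toL2 P (hrun.xError xstar 0 i))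
        (fun i => toL2 P (hrun.sError xstar 0 i)) ≤
      (4 * (1 + L ^ 2 / μ ^ 2) * c₂ + 4 * (c₁ + σ ^ 2) / μ ^ 2 + c₁ / μ ^ 2) * (n : ℝ) ^ 3 := by
    refine (S.energy_le hδ _ _).trans ?_
    refine initial_energy_arith (η := decreasingStepsize θ μ m (-1))
      (η₀ := decreasingStepsize θ μ m 0) hn1 hδ hδ' hμ ?_ ?_ ?_ ?_ (by positivity) (by positivity)
      hF hX ?_ ?_
    · unfold decreasingStepsize
      have : 0 < -1 + m := by linarith
      push_cast
      positivity
    · unfold decreasingStepsize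
      push_cast
      rw [div_le_div_iff₀ (by apply mul_pos hμ; linarith) hμ, one_mul, mul_comm]
      exact mul_le_mul_of_nonneg_left (by linarith) hμ.le
    · unfold decreasingStepsize
      push_cast
      rw [zero_add]
      positivity
    · unfold decreasingStepsize
      push_cast
      rw [zero_add, div_le_div_iff₀ (by positivity) hμ]
      rw [div_le_iff₀ hδ] at hm1
      have : θ ≤ m * δ := by linarith
      calc θ * μ ≤ (m * δ) * μ := mul_le_mul_of_nonneg_right this hμ.le
        _ = _ := by ring
    · rw [← hm] at hinit0
      have h1 := Finset.sum_le_sum fun i (_ : i ∈ Finset.univ) => hinit0 i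
      simp only [Finset.sum_add_distrib, ← Finset.mul_sum, Finset.sum_const, Finset.card_univ,
        Fintype.card_fin, nsmul_eq_mul] at h1
      refine le_trans (le_of_eq ?_) (h1.trans_eq (by ring))
      exact Finset.sum_congr rfl fun i _ => norm_sq_toL2 (hrun.xError xstar 0 i)
    · rw [Finset.mul_sum]
      refine Finset.sum_congr rfl fun i _ => ?_
      rw [norm_sq_toL2]
      have h1 : ∀ ω, (hrun.sError xstar 0 i).1 ω =
          decreasingStepsize θ μ m 0 • gradient (f i) xstar := fun ω => by
        rw [hm]
        exact zero_add _
      simp only [h1, norm_smul, mul_pow, Real.norm_eq_abs, sq_abs, integral_const,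
        probReal_univ, one_smul]
  have hn3 : (0 : ℝ) < (n : ℝ) ^ 3 := by positivity
  have key := hbound n δ m _ _ _ hn1 hδ hδ' hm1 hm2 ?_ ?_ ?_ ?_ hrec
  · have hT : 1 ≤ (n : ℝ) / (1 - lam2) := by
      rw [le_div_iff₀ (by linarith)]; linarith
    refine transientTime_le_ofReal hT (by linarith) fun k hk hk1 => ?_
    have hk' : B * n / δ ≤ k := by
      refine le_trans (le_of_eq ?_) hk
      rw [hlam]; field_simp
    have h1 := key k hk'
    rw [meanSquareError_eq hrun]
    have h2 := (S.sum_norm_sq_le (fun i => toL2 P (hrun.xError xstar k i))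
      (fun i => toL2 P (hrun.sError xstar k i))).trans h1
    calc _ ≤ 1 / (n : ℝ) * (A / k) := by gcongr
      _ = _ := by rw [div_mul_div_comm, one_mul]
  · calc 1 / δ = 4 * (1 / (1 - lam2)) := by rw [hlam]; field_simp
      _ ≤ 4 * (c₃ * (n : ℝ) ^ q) := by gcongr
      _ = _ := by ring
  · positivity
  · have h1 : 5 * θ ^ 2 / μ ^ 2 * ∑ i, ‖gradient (f i) xstar‖ ^ 2 ≤
        5 * θ ^ 2 / μ ^ 2 * (c₁ * (n : ℝ) ^ 3) := by gcongr
    have h2 : 0 ≤ (4 * (1 + L ^ 2 / μ ^ 2) * c₂ + 4 * (c₁ + σ ^ 2) / μ ^ 2 + c₁ / μ ^ 2) *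
      (n : ℝ) ^ 3 := by positivity
    linarith
  · have h2 : 0 ≤ 5 * θ ^ 2 / μ ^ 2 * c₁ * (n : ℝ) ^ 3 := by positivity
    refine hE0.trans ?_
    linarith
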